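/- **Theorem (Finslerian version of Beltrami's theorem, dimension $n>1$).** Let $M$ be a connected smooth manifold of dimension $n>1$, with slit tangent bundle $T_0M=TM\setminus\{0\}$, Liouville vector field $\mathcal C$ and vertical endomorphism $J$. A *spray* is a smooth vector field $S$ on $T_0M$ with $JS=\mathcal C$ and $[\mathcal C,S]=S$; its *geodesics* are the curves in $M$ whose velocity is an integral curve of $S$. With the Frölicher–Nijenhuis brackets put $h=\frac12(\mathrm{Id}-[S,J])$, $v=\frac12(\mathrm{Id}+[S,J])$ and $\Phi=v\circ[S,h]$ (the Jacobi endomorphism). The geodesic spray of a Finsler metric $F$ is the spray $S$ with $i_S\,dd_JF^2=-dF^2$, and $F$ has *constant flag curvature* if $\Phi=\kappa\,(F^2J-F\,d_JF\otimes\mathcal C)$ for a constant $\kappa\in\mathbb R$. (1) Let $F,\widetilde F$ be Finsler metrics on $M$ with geodesic sprays $S,\widetilde S$. If $S$ and $\widetilde S$ are projectively related, i.e. their geodesics coincide up to orientation preserving reparametrisation, then there is a positively $1$-homogeneous $P\in C^\infty(T_0M)$ (the projective factor) with $\widetilde S=S-2P\mathcal C$. For every positively $1$-homogeneous $P\in C^\infty(T_0M)$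 with $\widetilde S=S-2P\mathcal C$: if one of $F,\widetilde F$ has constant flag curvature, then the other has constant flag curvature if and only if $P$ is a Hamel function, i.e. $d_hd_JP=0$. (2) A spray is *isotropic* if $\Phi=\rho J-\alpha\otimes\mathcal C$ for a function $\rho\in C^\infty(T_0M)$ (necessarily the Ricci scalar $\frac1{n-1}\operatorname{Tr}\Phi$) and a semi-basic $1$-form $\alpha$ on $T_0M$; its curvature $1$-form is $\xi=\frac13(\alpha+d_J\rho)$. Let $S$ be an isotropic spray on $M$ with curvature $1$-form $\xi$, and let $\widetilde S=S-2P\mathcal C$ be a spray, with $P\in C^\infty(T_0M)$ positively $1$-homogeneous. Then $\widetilde S$ is isotropic, and its curvature $1$-form $\widetilde\xi$ satisfies $d_{\widetilde h}\widetilde\xi=d_h\xi$, where $\widetilde h$ is the horizontal projector of $\widetilde S$. -/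

import Mathlib

open scoped Manifold ContDiff Topology

noncomputable section

namespace SprayGeometry

variable {n : ℕ} {M : Type*} [TopologicalSpace M] [ChartedSpace (EuclideanSpace ℝ (Fin n)) M]
  [IsManifold (𝓡 n) ∞ M]

/-! ### Vector fields, functions and 1-forms on the slit tangent bundle

Objects on `T₀M` are total functions on `TM`, of which only the values on the open set `slit M`
matter. Tensor identities on `T₀M` are tested, at every `v ∈ T₀M`, on all vector fields that are
defined and smooth in a neighbourhood of `v`. -/

variable (M) in
/-- Vector fields on (subsets of) `TM`. -/
abbrev VField : Type _ :=
  (v : TangentBundle (𝓡 n) M) → TangentSpace (𝓡 n).tangent v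

variable (M) in
/-- 1-forms on (subsets of) `TM`. -/
abbrev OneForm : Type _ :=
  (v : TangentBundle (𝓡 n) M) → TangentSpace (𝓡 n).tangent v →L[ℝ] ℝ

variable (M) in
/-- The slit tangent bundle `T₀M`, as a subset of `TM`. -/
def slit : Set (TangentBundle (𝓡 n) M) := {v | v.2 ≠ 0}

/-- The vector field `X` is smooth in a neighbourhood of `v`. -/
def SmoothNear (X : VField (n := n) M) (v : TangentBundle (𝓡 n) M) : Prop :=
  ∀ᶠ w in 𝓝 v, ContMDiffAt (𝓡 n).tangent (𝓡 n).tangent.tangent ∞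
    (fun w => (⟨w, X w⟩ : TangentBundle (𝓡 n).tangent (TangentBundle (𝓡 n) M))) w

/-- `X` is a smooth vector field on `T₀M`. -/
def IsSmoothField (X : VField (n := n) M) : Prop :=
  ∀ v ∈ slit M, SmoothNear X v

/-- `f ∈ C^∞(T₀M)`. -/
def IsSmoothFun (f : TangentBundle (𝓡 n) M → ℝ) : Prop :=
  ContMDiffOn (𝓡 n).tangent 𝓘(ℝ, ℝ) ∞ f (slit M)

/-- `η` is a smooth 1-form on `T₀M`: it maps smooth vector fields to smooth functions. -/
def IsSmoothForm (η : OneForm (n := n) M) : Prop :=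
  ∀ v ∈ slit M, ∀ X : VField (n := n) M, SmoothNear X v →
    ContMDiffAt (𝓡 n).tangent 𝓘(ℝ, ℝ) ∞ (fun w => η w (X w)) v

/-- Positive `1`-homogeneity on `T₀M`. -/
def PosHomogeneous (f : TangentBundle (𝓡 n) M → ℝ) : Prop :=
  ∀ v ∈ slit M, ∀ t : ℝ, 0 < t → f ⟨v.1, t • v.2⟩ = t * f v

/-! ### The Liouville field and the vertical endomorphism -/

/-- The vertical lift at `v ∈ T_pM` of a vector `u ∈ T_pM`: the image of `u` under the derivative
at `v` of the inclusion of the fibre `T_pM` (a vector space) into `TM`. -/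
def vertLift (v : TangentBundle (𝓡 n) M) :
    EuclideanSpace ℝ (Fin n) →L[ℝ] TangentSpace (𝓡 n).tangent v :=
  mfderiv 𝓘(ℝ, EuclideanSpace ℝ (Fin n)) (𝓡 n).tangent
    (fun u : EuclideanSpace ℝ (Fin n) => (⟨v.1, u⟩ : TangentBundle (𝓡 n) M)) v.2

/-- The derivative at `v` of the projection `TM → M`. -/
def dproj (v : TangentBundle (𝓡 n) M) :
    TangentSpace (𝓡 n).tangent v →L[ℝ] EuclideanSpace ℝ (Fin n) :=
  mfderiv (𝓡 n).tangent (𝓡 n) (fun w : TangentBundle (𝓡 n) M => w.1) v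

/-- The Liouville (dilation) vector field `𝒞`. -/
def liouville : VField (n := n) M := fun v => vertLift v v.2

/-- The vertical endomorphism `J`. -/
def vertEnd (v : TangentBundle (𝓡 n) M) :
    TangentSpace (𝓡 n).tangent v →L[ℝ] TangentSpace (𝓡 n).tangent v :=
  (vertLift v).comp (dproj v)

/-- `J` acting on vector fields. -/
def opJ (X : VField (n := n) M) : VField (n := n) M := fun v => vertEnd v (X v)

/-- The Lie bracket of vector fields on `TM`. -/
def bracket (X Y : VField (n := n) M) : VField (n := n) M :=
  VectorField.mlieBracket (𝓡 n).tangent X Y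

/-! ### The Frölicher–Nijenhuis calculus

A vector-valued 1-form is represented by its action `X ↦ L X` on vector fields. -/

/-- The Frölicher–Nijenhuis bracket `[S, L]` of a vector field and a vector-valued 1-form:
`[S, L] X = [S, L X] - L [S, X]`. -/
def fnBracket (S : VField (n := n) M) (L : VField (n := n) M → VField (n := n) M)
    (X : VField (n := n) M) : VField (n := n) M :=
  bracket S (L X) - L (bracket S X)

/-- `X(f)`, the derivative of the function `f` along the vector field `X`. -/
def deriveAlong (X : VField (n := n) M) (f : TangentBundle (𝓡 n) M → ℝ)
    (v : TangentBundle (𝓡 n) M) : ℝ :=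
  mvfderiv (𝓡 n).tangent f v (X v)

/-- The semi-basic 1-form `d_J f = df ∘ J`. -/
def dJ (f : TangentBundle (𝓡 n) M → ℝ) : OneForm (n := n) M :=
  fun v => (mvfderiv (𝓡 n).tangent f v).comp (vertEnd v)

/-- The exterior derivative of a 1-form, `(dη)(X, Y)`. -/
def extD (η : OneForm (n := n) M) (X Y : VField (n := n) M) (v : TangentBundle (𝓡 n) M) : ℝ :=
  deriveAlong X (fun w => η w (Y w)) v - deriveAlong Y (fun w => η w (X w)) v
    - η v (bracket X Y v)

/-- The derivation `d_L = [i_L, d]` along a vector-valued 1-form `L`, applied to a 1-form `η`: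
`(d_L η)(X, Y) = (L X)(η Y) - (L Y)(η X) - η([L X, Y] + [X, L Y] - L [X, Y])`. -/
def dAlong (L : VField (n := n) M → VField (n := n) M) (η : OneForm (n := n) M)
    (X Y : VField (n := n) M) (v : TangentBundle (𝓡 n) M) : ℝ :=
  deriveAlong (L X) (fun w => η w (Y w)) v - deriveAlong (L Y) (fun w => η w (X w)) v
    - η v (bracket (L X) Y v + bracket X (L Y) v - L (bracket X Y) v)

/-- The 1-form `η` is semi-basic on `T₀M`: it vanishes on vertical vectors. -/
def IsSemibasic (η : OneForm (n := n) M) : Prop :=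
  ∀ v ∈ slit M, ∀ w, dproj v w = 0 → η v w = 0

/-! ### Sprays -/

/-- `S` is a spray: a smooth vector field on `T₀M` with `J S = 𝒞` and `[𝒞, S] = S`. -/
structure IsSpray (S : VField (n := n) M) : Prop where
  smooth : IsSmoothField S
  vertEnd_apply : ∀ v ∈ slit M, vertEnd v (S v) = liouville v
  homogeneous : ∀ v ∈ slit M, bracket liouville S v = S v

/-- The horizontal projector `h = (Id - [S, J]) / 2`. -/
def opH (S X : VField (n := n) M) : VField (n := n) M :=
  (1 / 2 : ℝ) • (X - fnBracket S opJ X)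

/-- The vertical projector `v = (Id + [S, J]) / 2`. -/
def opV (S X : VField (n := n) M) : VField (n := n) M :=
  (1 / 2 : ℝ) • (X + fnBracket S opJ X)

/-- The Jacobi endomorphism `Φ = v ∘ [S, h]`. -/
def jacobiEnd (S X : VField (n := n) M) : VField (n := n) M :=
  opV S (fnBracket S (opH S) X)

/-- The Jacobi endomorphism of `S` has the form `Φ = ρ J - α ⊗ 𝒞` with a function
`ρ ∈ C^∞(T₀M)` and a semi-basic 1-form `α` on `T₀M`. For a spray in dimension `n > 1` these are
unique on `T₀M`: taking the semi-basic trace and using `Φ(S) = 0` one sees that `ρ = i_S α` is the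
Ricci scalar `Tr Φ / (n - 1)`. -/
structure IsIsotropicWith (S : VField (n := n) M) (ρ : TangentBundle (𝓡 n) M → ℝ)
    (α : OneForm (n := n) M) : Prop where
  smooth_ricci : IsSmoothFun ρ
  smooth_form : IsSmoothForm α
  semibasic : IsSemibasic α
  jacobi : ∀ v ∈ slit M, ∀ X : VField (n := n) M, SmoothNear X v →
    jacobiEnd S X v = ρ v • opJ X v - α v (X v) • liouville v

/-- `ξ` is the curvature 1-form `(α + d_J ρ) / 3` of the isotropic spray `S`. -/
def IsCurvatureForm (S : VField (n := n) M) (ξ : OneForm (n := n) M) : Prop :=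
  ∃ ρ α, IsIsotropicWith S ρ α ∧ ∀ v ∈ slit M, ξ v = (1 / 3 : ℝ) • (α v + dJ ρ v)

/-- The velocity `ċ(t) ∈ TM` of a curve `c` in `M`. -/
def velocity (c : ℝ → M) (t : ℝ) : TangentBundle (𝓡 n) M :=
  ⟨c t, mfderiv 𝓘(ℝ, ℝ) (𝓡 n) c t (1 : ℝ)⟩

/-- The curve `c`, on the open interval `A`, is a geodesic of `S`: its velocity is an integral
curve of `S` in `T₀M`. (Such a curve is automatically smooth on `A`.) -/
def IsGeodesicOn (S : VField (n := n) M) (c : ℝ → M) (A : Set ℝ) : Prop :=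
  (∀ t ∈ A, velocity (n := n) c t ∈ slit M) ∧
    IsMIntegralCurveOn (I := (𝓡 n).tangent) (velocity c) S A

/-- Every geodesic of `S`, defined on an open interval `A`, becomes a geodesic of `S'` after an
orientation preserving reparametrisation `φ : B → A`. -/
def GeodesicsReparametrise (S S' : VField (n := n) M) : Prop :=
  ∀ (c : ℝ → M) (A : Set ℝ), IsOpen A → A.OrdConnected → IsGeodesicOn S c A →
    ∃ (B : Set ℝ) (φ : ℝ → ℝ), IsOpen B ∧ B.OrdConnected ∧ ContDiffOn ℝ ∞ φ B ∧
      (∀ s ∈ B, 0 < deriv φ s) ∧ φ '' B = A ∧ IsGeodesicOn S' (c ∘ φ) B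

/-- Two sprays are projectively related: their geodesics coincide up to an orientation preserving
reparametrisation. -/
def ProjectivelyRelated (S S' : VField (n := n) M) : Prop :=
  GeodesicsReparametrise S S' ∧ GeodesicsReparametrise S' S

/-- `S' = S - 2 P 𝒞` on `T₀M`, with a positively `1`-homogeneous `P ∈ C^∞(T₀M)`. -/
structure IsProjectiveFactor (S S' : VField (n := n) M) (P : TangentBundle (𝓡 n) M → ℝ) :
    Prop where
  smooth : IsSmoothFun P
  homogeneous : PosHomogeneous P
  eq : ∀ v ∈ slit M, S' v = S v - (2 * P v) • liouville v

/-- `P` is a Hamel function of the spray `S`: smooth on `T₀M`, positively `1`-homogeneous, and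
`d_h d_J P = 0`. -/
structure IsHamel (S : VField (n := n) M) (P : TangentBundle (𝓡 n) M → ℝ) : Prop where
  smooth : IsSmoothFun P
  homogeneous : PosHomogeneous P
  hamel : ∀ v ∈ slit M, ∀ X Y : VField (n := n) M, SmoothNear X v → SmoothNear Y v →
    dAlong (opH S) (dJ P) X Y v = 0

/-! ### Finsler metrics -/

/-- `F` is a Finsler metric: smooth and positive on `T₀M`, zero on the zero section, positively
`1`-homogeneous, and with positive definite fundamental tensor (the Hessian of `F² / 2` along the
fibre). -/
structure IsFinsler (F : TangentBundle (𝓡 n) M → ℝ) : Prop where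
  smooth : IsSmoothFun F
  pos : ∀ v ∈ slit M, 0 < F v
  zero : ∀ p : M, F ⟨p, 0⟩ = 0
  homogeneous : PosHomogeneous F
  hessian_pos : ∀ v ∈ slit M, ∀ u : TangentSpace (𝓡 n) v.1, u ≠ 0 →
    0 < iteratedDeriv 2 (fun s : ℝ => F ⟨v.1, v.2 + s • u⟩ ^ 2 / 2) 0

/-- `S` is the geodesic spray of `F`: the spray determined by `i_S d d_J F² = - d F²`. -/
structure IsGeodesicSpray (F : TangentBundle (𝓡 n) M → ℝ) (S : VField (n := n) M) : Prop where
  isSpray : IsSpray S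
  euler_lagrange : ∀ v ∈ slit M, ∀ X : VField (n := n) M, SmoothNear X v →
    extD (dJ (fun w => F w ^ 2)) S X v = - deriveAlong X (fun w => F w ^ 2) v

/-- The Finsler metric `F`, with geodesic spray `S`, has constant flag curvature:
`Φ = κ (F² J - F d_J F ⊗ 𝒞)` on `T₀M` for a constant `κ`. -/
def HasConstantFlagCurvature (F : TangentBundle (𝓡 n) M → ℝ) (S : VField (n := n) M) : Prop :=
  ∃ κ : ℝ, ∀ v ∈ slit M, ∀ X : VField (n := n) M, SmoothNear X v →
    jacobiEnd S X v = κ • (F v ^ 2 • opJ X v - (F v * dJ F v (X v)) • liouville v)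

end SprayGeometry

end

/-!
Everything is computed in the charts `(x, y)` of `TM`, in which a spray is
`S = y ∂/∂x - 2 G ∂/∂y` with `G` positively `2`-homogeneous in `y` (`IsSpray.loc_eq`,
`IsSpray.coeff_euler`). Pulling back along the inverse of a chart turns Lie brackets, and with them
the Frölicher-Nijenhuis calculus, into derivatives of `G`: the horizontal projector is
`a ↦ (a, -N a)` with `N = ∂G/∂y` (`IsSpray.loc_opH`), the Jacobi endomorphism is `jac`
(`IsSpray.loc_jacobiEnd`), and `d_h` of a semi-basic form is `dhForm` (`IsSpray.dAlong_opH`). The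
relation `S' = S - 2 P 𝒞` becomes `G' = G + P y`.

*Existence of the projective factor.* If `x` is a geodesic of `S` and `x ∘ φ` one of `S'`, then
`x'' = -2 G(x, x')` and `(x ∘ φ)'' = -2 φ'² G'(x, x')` show that `G' - G` is a multiple of `y`
(`GeodesicsReparametrise.exists_coeff`). The factor is smooth and homogeneous because `G` and `G'`
are.

*Isotropic sprays.* A projective change transforms the Jacobi endomorphism by
`Φ' = Φ + (P² - S P) J - (d_J (S P) + P d_J P - 3 d_h P) ⊗ 𝒞` (`jac_proj`). Hence isotropy is
preserved, and, since `ρ` and `α` are unique in dimension `n > 1` (`IsoOn.unique`), the curvature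
form becomes `ξ' = ξ + P d_J P - d_h P` (`curvForm_proj`). The curvature of the nonlinear connection
is the vertical differential of `Φ` divided by three, so that for an isotropic spray it is
`ξ ∧ J - d_J ξ ⊗ 𝒞` (`IsoOn.curv`). Inserting this in the commutator of the horizontal derivatives
of `P` gives `d_h' ξ' = d_h ξ` (`dhForm_proj`).

*Constant flag curvature.* Let `F` have constant flag curvature `κ`; its spray is isotropic with
`ρ = κ F²` and `α = d_J ρ / 2`. The same relation `α' = d_J ρ' / 2` for the changed spray says that
`d_J (S P) = 2 d_h P`, which is equivalent to `d_h d_J P = 0` (`hamel_iff`). It holds if `F'` has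
constant flag curvature, which is one implication (`ConstFlag.hamel`). Conversely, if it holds, then
the fact that `F'²` is constant along the image of the Jacobi endomorphism of `S'` gives
`ρ' = k F'²` with a function `k` on the base. By the projective invariance of `d_h ξ`, and because
`d_h d_J F² = 0` for the geodesic spray of every Finsler metric, `dk ∧ d_J F'² = 0`
(`ConstFlag.of_hamel`). Evaluating this on a nonzero vector of the kernel of `dk`, which exists as
`n > 1`, yields `dk = 0` (`locally_const_of_wedge`), and `k` is constant as `M` is connected. The
roles of `F` and `F'` can be exchanged, since `S = S' - 2 (-P) 𝒞` and `d_h d_J P = d_h' d_J P`.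
-/


set_option linter.unusedSectionVars false

noncomputable section

namespace SprayGeometry

section

variable {n : ℕ} {M : Type*} [TopologicalSpace M] [ChartedSpace (EuclideanSpace ℝ (Fin n)) M]
  [IsManifold (𝓡 n) ∞ M]

/-! ### Charts of the tangent bundle -/

/-- The model space `ℝⁿ` of the manifold. -/
abbrev Model (n : ℕ) : Type := EuclideanSpace ℝ (Fin n)

/-- The local parametrisation of `TM` by pairs `(x, y)` (base coordinates, fibre coordinates)
inverse to the preferred chart at `q`. -/
def param (q : TangentBundle (𝓡 n) M) (z : Model n × Model n) : TangentBundle (𝓡 n) M :=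
  (extChartAt (𝓡 n).tangent q).symm z

/-- The domain of `param q`. -/
def coordDomain (q : TangentBundle (𝓡 n) M) : Set (Model n × Model n) :=
  {z | z.1 ∈ (extChartAt (𝓡 n) q.1).target}

/-- The part of the domain of `param q` which parametrises `T₀M`. -/
def slitDomain (q : TangentBundle (𝓡 n) M) : Set (Model n × Model n) :=
  {z | z.1 ∈ (extChartAt (𝓡 n) q.1).target ∧ z.2 ≠ 0}

/-- The linear isomorphism by which `param q` acts on the fibre over the point with base
coordinates `x`. -/
def fibreMap (q : TangentBundle (𝓡 n) M) (x : Model n) : Model n →L[ℝ] Model n :=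
  tangentCoordChange (𝓡 n) q.1 ((extChartAt (𝓡 n) q.1).symm x) ((extChartAt (𝓡 n) q.1).symm x)

/-- The inverse of `fibreMap q x`. -/
def fibreMapInv (q : TangentBundle (𝓡 n) M) (x : Model n) : Model n →L[ℝ] Model n :=
  tangentCoordChange (𝓡 n) ((extChartAt (𝓡 n) q.1).symm x) q.1 ((extChartAt (𝓡 n) q.1).symm x)

/-- The derivative of `param q`. -/
def paramD (q : TangentBundle (𝓡 n) M) (z : Model n × Model n) :
    (Model n × Model n) →L[ℝ] TangentSpace (𝓡 n).tangent (param q z) :=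
  mfderiv 𝓘(ℝ, Model n × Model n) (𝓡 n).tangent (param q) z

lemma isOpen_coordDomain (q : TangentBundle (𝓡 n) M) : IsOpen (coordDomain q) :=
  (isOpen_extChartAt_target q.1).preimage continuous_fst

lemma isOpen_slitDomain (q : TangentBundle (𝓡 n) M) : IsOpen (slitDomain q) :=
  (isOpen_coordDomain q).inter (isOpen_compl_singleton.preimage continuous_snd)

lemma extChartAt_target_eq (q : TangentBundle (𝓡 n) M) :
    (extChartAt (𝓡 n).tangent q).target = coordDomain q := by
  ext z
  rw [FiberBundle.extChartAt_target]
  simp only [TangentBundle.trivializationAt_baseSet, Set.mem_prod, Set.mem_inter_iff,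
    Set.mem_preimage, Set.mem_univ, and_true, coordDomain, Set.mem_ofPred_eq]
  refine ⟨fun h => h.1, fun h => ⟨h, ?_⟩⟩
  rw [← extChartAt_source (𝓡 n)]
  exact (extChartAt (𝓡 n) q.1).map_target h

lemma param_mk (q : TangentBundle (𝓡 n) M) (z : Model n × Model n) :
    param q z = ⟨(extChartAt (𝓡 n) q.1).symm z.1, fibreMap q z.1 z.2⟩ := rfl

lemma fibreMap_fibreMapInv {q : TangentBundle (𝓡 n) M} {x : Model n}
    (hx : x ∈ (extChartAt (𝓡 n) q.1).target) (u : Model n) :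
    fibreMap q x (fibreMapInv q x u) = u := by
  have h := (extChartAt (𝓡 n) q.1).map_target hx
  have h' := mem_extChartAt_source (I := 𝓡 n) ((extChartAt (𝓡 n) q.1).symm x)
  rw [fibreMap, fibreMapInv, tangentCoordChange_comp ⟨⟨h', h⟩, h'⟩, tangentCoordChange_self h']

lemma fibreMapInv_fibreMap {q : TangentBundle (𝓡 n) M} {x : Model n}
    (hx : x ∈ (extChartAt (𝓡 n) q.1).target) (u : Model n) :
    fibreMapInv q x (fibreMap q x u) = u := by
  have h := (extChartAt (𝓡 n) q.1).map_target hx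
  have h' := mem_extChartAt_source (I := 𝓡 n) ((extChartAt (𝓡 n) q.1).symm x)
  rw [fibreMap, fibreMapInv, tangentCoordChange_comp ⟨⟨h, h'⟩, h⟩, tangentCoordChange_self h]

lemma fibreMap_eq_zero {q : TangentBundle (𝓡 n) M} {x : Model n}
    (hx : x ∈ (extChartAt (𝓡 n) q.1).target) {u : Model n} : fibreMap q x u = 0 ↔ u = 0 := by
  refine ⟨fun h => ?_, fun h => by rw [h, map_zero]⟩
  rw [← fibreMapInv_fibreMap hx u, h, map_zero]

/-- `fibreMap` is the derivative of the inverse of the chart of the base. -/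
lemma hasMFDerivAt_base {q : TangentBundle (𝓡 n) M} {x : Model n}
    (hx : x ∈ (extChartAt (𝓡 n) q.1).target) :
    HasMFDerivAt 𝓘(ℝ, Model n) (𝓡 n) (extChartAt (𝓡 n) q.1).symm x (fibreMap q x) := by
  refine ⟨(continuousAt_extChartAt_symm'' hx), ?_⟩
  have h := (extChartAt (𝓡 n) q.1).map_target hx
  have h' := mem_extChartAt_source (I := 𝓡 n) ((extChartAt (𝓡 n) q.1).symm x)
  have := hasFDerivWithinAt_tangentCoordChange (I := 𝓡 n) ⟨h, h'⟩
  rw [(extChartAt (𝓡 n) q.1).right_inv hx] at this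
  rw [ModelWithCorners.range_eq_univ] at this ⊢
  exact this

lemma contMDiffAt_param {q : TangentBundle (𝓡 n) M} {z : Model n × Model n}
    (hz : z ∈ coordDomain q) :
    ContMDiffAt 𝓘(ℝ, Model n × Model n) (𝓡 n).tangent ∞ (param q) z := by
  have := contMDiffOn_extChartAt_symm (I := (𝓡 n).tangent) (n := ∞) q
  rw [extChartAt_target_eq] at this
  exact this.contMDiffAt ((isOpen_coordDomain q).mem_nhds hz)

lemma hasMFDerivAt_param {q : TangentBundle (𝓡 n) M} {z : Model n × Model n}
    (hz : z ∈ coordDomain q) :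
    HasMFDerivAt 𝓘(ℝ, Model n × Model n) (𝓡 n).tangent (param q) z (paramD q z) :=
  ((contMDiffAt_param hz).mdifferentiableAt (by simp)).hasMFDerivAt

lemma isInvertible_paramD {q : TangentBundle (𝓡 n) M} {z : Model n × Model n}
    (hz : z ∈ coordDomain q) : (paramD q z).IsInvertible := by
  rw [← extChartAt_target_eq] at hz
  have := isInvertible_mfderivWithin_extChartAt_symm (I := (𝓡 n).tangent) hz
  rw [ModelWithCorners.range_eq_univ, mfderivWithin_univ] at this
  exact this

/-- Coordinate vectors along the fibre are vertical lifts. -/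
lemma paramD_vertical {q : TangentBundle (𝓡 n) M} {z : Model n × Model n}
    (hz : z ∈ coordDomain q) (a : Model n) :
    paramD q z (0, a) = vertLift (param q z) (fibreMap q z.1 a) := by
  have h1 : HasMFDerivAt 𝓘(ℝ, Model n) 𝓘(ℝ, Model n × Model n)
      (fun u : Model n => (z.1, fibreMapInv q z.1 u)) (fibreMap q z.1 z.2)
      ((ContinuousLinearMap.inr ℝ (Model n) (Model n)).comp (fibreMapInv q z.1)) := by
    apply HasFDerivAt.hasMFDerivAt
    exact ((hasFDerivAt_const z.1 (fibreMap q z.1 z.2)).prodMk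
      (fibreMapInv q z.1).hasFDerivAt).congr_fderiv (ContinuousLinearMap.ext fun _ => rfl)
  have e1 : (z.1, fibreMapInv q z.1 (fibreMap q z.1 z.2)) = z := by
    rw [fibreMapInv_fibreMap hz]
  have h2 := hasMFDerivAt_param hz
  have h3 : HasMFDerivAt 𝓘(ℝ, Model n × Model n) (𝓡 n).tangent (param q)
    (z.1, fibreMapInv q z.1 (fibreMap q z.1 z.2)) (paramD q z) := by rw [e1]; exact h2
  have h4 := HasMFDerivAt.comp (f := fun u : Model n => (z.1, fibreMapInv q z.1 u))
    (fibreMap q z.1 z.2) h3 h1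
  have e2 : (param q ∘ fun u : Model n => (z.1, fibreMapInv q z.1 u)) =
      fun u : Model n => (⟨(param q z).1, u⟩ : TangentBundle (𝓡 n) M) := by
    funext u
    simp only [Function.comp, param_mk, fibreMap_fibreMapInv hz]
  rw [e2] at h4
  have h5 := h4.mfderiv
  have h6 : vertLift (param q z) (fibreMap q z.1 a) = paramD q z
      (ContinuousLinearMap.inr ℝ (Model n) (Model n)
        (fibreMapInv q z.1 (fibreMap q z.1 a))) :=
    congrArg (fun L : Model n →L[ℝ] Model n × Model n => L (fibreMap q z.1 a)) h5
  rw [h6, fibreMapInv_fibreMap hz]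
  rfl

lemma dproj_paramD {q : TangentBundle (𝓡 n) M} {z : Model n × Model n}
    (hz : z ∈ coordDomain q) (w : Model n × Model n) :
    dproj (param q z) (paramD q z w) = fibreMap q z.1 w.1 := by
  have h1 : HasMFDerivAt (𝓡 n).tangent (𝓡 n) (fun w : TangentBundle (𝓡 n) M => w.1) (param q z)
      (dproj (param q z)) := by
    apply MDifferentiableAt.hasMFDerivAt
    exact (Bundle.contMDiff_proj (n := ∞) (TangentSpace (𝓡 n) : M → Type _)).mdifferentiable
      (by simp) _
  have h2 := h1.comp z (hasMFDerivAt_param hz)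
  have h3 : HasMFDerivAt 𝓘(ℝ, Model n × Model n) (𝓡 n)
      ((extChartAt (𝓡 n) q.1).symm ∘ Prod.fst) z
      ((fibreMap q z.1).comp (ContinuousLinearMap.fst ℝ (Model n) (Model n))) := by
    refine (hasMFDerivAt_base hz).comp z ?_
    exact (hasFDerivAt_fst (p := z)).hasMFDerivAt
  have := hasMFDerivAt_unique h2 h3
  exact congrArg (fun L : (Model n × Model n) →L[ℝ] Model n => L w) this

lemma param_mem_slit {q : TangentBundle (𝓡 n) M} {z : Model n × Model n}
    (hz : z ∈ slitDomain q) : param q z ∈ slit M := by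
  intro h
  exact hz.2 ((fibreMap_eq_zero hz.1).1 h)

lemma exists_param {q v : TangentBundle (𝓡 n) M} (hv : v.1 ∈ (extChartAt (𝓡 n) q.1).source) :
    ∃ z ∈ coordDomain q, param q z = v := by
  have : v ∈ (extChartAt (𝓡 n).tangent q).source := by
    rw [extChartAt_source]
    rw [extChartAt_source] at hv
    simpa using hv
  refine ⟨extChartAt (𝓡 n).tangent q v, ?_, (extChartAt (𝓡 n).tangent q).left_inv this⟩
  rw [← extChartAt_target_eq]
  exact (extChartAt (𝓡 n).tangent q).map_source this

lemma exists_param_slit {q v : TangentBundle (𝓡 n) M}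
    (hq : v.1 ∈ (extChartAt (𝓡 n) q.1).source) (hv : v ∈ slit M) :
    ∃ z ∈ slitDomain q, param q z = v := by
  obtain ⟨z, hz, rfl⟩ := exists_param hq
  refine ⟨z, ⟨hz, fun h => hv ?_⟩, rfl⟩
  rw [param_mk]
  exact (fibreMap_eq_zero hz).2 h

lemma exists_chart {v : TangentBundle (𝓡 n) M} (hv : v ∈ slit M) :
    ∃ q : TangentBundle (𝓡 n) M, ∃ z ∈ slitDomain q, param q z = v :=
  ⟨v, exists_param_slit (mem_extChartAt_source v.1) hv⟩

end

section

variable {n : ℕ} {M : Type*} [TopologicalSpace M] [ChartedSpace (EuclideanSpace ℝ (Fin n)) M]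
  [IsManifold (𝓡 n) ∞ M]

/-! ### Vector fields, functions and brackets in a chart -/

/-- The expression of the vector field `X` in the chart at `q`. -/
def loc (q : TangentBundle (𝓡 n) M) (X : VField (n := n) M) (z : Model n × Model n) :
    Model n × Model n :=
  (paramD q z).inverse (X (param q z))

lemma eq_inverse_of_comp_eq_id {V W : Type*} [AddCommGroup V] [Module ℝ V] [TopologicalSpace V]
    [AddCommGroup W] [Module ℝ W] [TopologicalSpace W] {L : W →L[ℝ] V} {D : V →L[ℝ] W}
    (hD : D.IsInvertible) (h : L.comp D = ContinuousLinearMap.id ℝ V) : L = D.inverse := by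
  obtain ⟨e, rfl⟩ := hD
  rw [ContinuousLinearMap.inverse_equiv]
  ext w
  have := congrArg (fun A : V →L[ℝ] V => A (e.symm w)) h
  simpa using this

section Basic

variable {q : TangentBundle (𝓡 n) M} {z : Model n × Model n}

lemma paramD_loc (hz : z ∈ coordDomain q) (X : VField (n := n) M) :
    paramD q z (loc q X z) = X (param q z) :=
  (isInvertible_paramD hz).self_apply_inverse _

lemma paramD_injective (hz : z ∈ coordDomain q) : Function.Injective (paramD q z) :=
  (isInvertible_paramD hz).injective

lemma loc_eq (hz : z ∈ coordDomain q) {X : VField (n := n) M} {w : Model n × Model n}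
    (h : X (param q z) = paramD q z w) : loc q X z = w :=
  paramD_injective hz ((paramD_loc hz X).trans h)

lemma vertEnd_paramD (hz : z ∈ coordDomain q) (w : Model n × Model n) :
    vertEnd (param q z) (paramD q z w) = paramD q z (0, w.1) := by
  rw [vertEnd, ContinuousLinearMap.comp_apply, dproj_paramD hz, paramD_vertical hz]

lemma loc_opJ (hz : z ∈ coordDomain q) (X : VField (n := n) M) :
    loc q (opJ X) z = (0, (loc q X z).1) := by
  apply loc_eq hz
  rw [← vertEnd_paramD hz, paramD_loc hz]
  rfl

lemma liouville_param (hz : z ∈ coordDomain q) :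
    (liouville : VField (n := n) M) (param q z) = paramD q z (0, z.2) := by
  rw [paramD_vertical hz]
  rfl

lemma loc_liouville (hz : z ∈ coordDomain q) : loc q liouville z = (0, z.2) :=
  loc_eq hz (liouville_param hz)

lemma loc_add (hz : z ∈ coordDomain q) (X Y : VField (n := n) M) :
    loc q (X + Y) z = loc q X z + loc q Y z := by
  apply loc_eq hz
  rw [map_add, paramD_loc hz, paramD_loc hz]
  rfl

lemma loc_sub (hz : z ∈ coordDomain q) (X Y : VField (n := n) M) :
    loc q (X - Y) z = loc q X z - loc q Y z := by
  apply loc_eq hz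
  rw [map_sub, paramD_loc hz, paramD_loc hz]
  rfl

lemma loc_smul (hz : z ∈ coordDomain q) (c : ℝ) (X : VField (n := n) M) :
    loc q (c • X) z = c • loc q X z := by
  apply loc_eq hz
  rw [map_smul, paramD_loc hz]
  rfl

lemma loc_congr {X Y : VField (n := n) M} (h : X (param q z) = Y (param q z)) :
    loc q X z = loc q Y z := by rw [loc, h, loc]

lemma eq_of_loc_eq (hz : z ∈ coordDomain q) {X Y : VField (n := n) M}
    (h : loc q X z = loc q Y z) : X (param q z) = Y (param q z) := by
  rw [← paramD_loc hz X, h, paramD_loc hz]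

lemma eventually_param {p : TangentBundle (𝓡 n) M → Prop} (hz : z ∈ coordDomain q)
    (h : ∀ᶠ w in 𝓝 (param q z), p w) : ∀ᶠ z' in 𝓝 z, p (param q z') :=
  (contMDiffAt_param hz).continuousAt.eventually h

lemma eventually_of_param {p : TangentBundle (𝓡 n) M → Prop} (hz : z ∈ coordDomain q)
    (h : ∀ᶠ z' in 𝓝 z, p (param q z')) : ∀ᶠ w in 𝓝 (param q z), p w := by
  have hs : param q z ∈ (extChartAt (𝓡 n).tangent q).source := by
    apply (extChartAt (𝓡 n).tangent q).map_target
    rw [extChartAt_target_eq]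
    exact hz
  have hr : extChartAt (𝓡 n).tangent q (param q z) = z := by
    apply (extChartAt (𝓡 n).tangent q).right_inv
    rw [extChartAt_target_eq]
    exact hz
  have hc := continuousAt_extChartAt' (I := (𝓡 n).tangent) hs
  have h' : ∀ᶠ w in 𝓝 (param q z), p (param q (extChartAt (𝓡 n).tangent q w)) := by
    refine hc.eventually (p := fun z' => p (param q z')) ?_
    rw [hr]
    exact h
  filter_upwards [h', (isOpen_extChartAt_source q).mem_nhds hs] with w hw hw'
  rwa [param, (extChartAt (𝓡 n).tangent q).left_inv hw'] at hw

lemma SmoothNear.eventually {X : VField (n := n) M} {v : TangentBundle (𝓡 n) M}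
    (h : SmoothNear X v) : ∀ᶠ w in 𝓝 v, SmoothNear X w :=
  eventually_eventually_nhds.2 h

lemma SmoothNear.contMDiffAt {X : VField (n := n) M} {v : TangentBundle (𝓡 n) M}
    (h : SmoothNear X v) : ContMDiffAt (𝓡 n).tangent (𝓡 n).tangent.tangent ∞
    (fun w => (⟨w, X w⟩ : TangentBundle (𝓡 n).tangent (TangentBundle (𝓡 n) M))) v :=
  h.self_of_nhds

lemma SmoothNear.contDiffAt_loc {X : VField (n := n) M} (hz : z ∈ coordDomain q)
    (h : SmoothNear X (param q z)) : ContDiffAt ℝ ∞ (loc q X) z := by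
  refine contMDiffAt_vectorSpace_iff_contDiffAt.1 ?_
  rw [← contMDiffWithinAt_univ]
  exact ContMDiffWithinAt.mpullback_vectorField_preimage (n := ∞) (t := Set.univ)
    h.contMDiffAt.contMDiffWithinAt (contMDiffAt_param hz) (isInvertible_paramD hz) (by simp)

/-- Lie brackets commute with the pullback along `param q`. -/
lemma loc_bracket (hz : z ∈ coordDomain q) {X Y : VField (n := n) M}
    (hX : SmoothNear X (param q z)) (hY : SmoothNear Y (param q z)) :
    loc q (bracket X Y) z =
      fderiv ℝ (loc q Y) z (loc q X z) - fderiv ℝ (loc q X) z (loc q Y z) := by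
  have : IsManifold (𝓡 n).tangent (minSmoothness ℝ 2) (TangentBundle (𝓡 n) M) := by
    rw [minSmoothness_of_isRCLikeNormedField]
    exact inferInstance
  have : IsManifold (𝓡 n).tangent (minSmoothness ℝ 3) (TangentBundle (𝓡 n) M) := by
    rw [minSmoothness_of_isRCLikeNormedField]
    exact inferInstance
  have := VectorField.mpullback_mlieBracket (I := 𝓘(ℝ, Model n × Model n)) (n := ∞)
    (hX.contMDiffAt.mdifferentiableAt (by simp)) (hY.contMDiffAt.mdifferentiableAt (by simp))
    (contMDiffAt_param hz) (by
      rw [minSmoothness_of_isRCLikeNormedField]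
      exact ENat.LEInfty.out)
  rw [← VectorField.mlieBracketWithin_univ (I := 𝓘(ℝ, Model n × Model n)),
    VectorField.mlieBracketWithin_eq_lieBracketWithin] at this
  have h : loc q (bracket X Y) z =
      VectorField.lieBracketWithin ℝ (loc q X) (loc q Y) Set.univ z := this
  rw [h, VectorField.lieBracketWithin_univ]
  rfl

lemma SmoothNear.bracket {X Y : VField (n := n) M} {v : TangentBundle (𝓡 n) M}
    (hX : SmoothNear X v) (hY : SmoothNear Y v) : SmoothNear (bracket X Y) v := by
  have : IsManifold (𝓡 n).tangent (minSmoothness ℝ 3) (TangentBundle (𝓡 n) M) := by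
    rw [minSmoothness_of_isRCLikeNormedField]
    exact inferInstance
  have : IsManifold (𝓡 n).tangent (∞ + 1) (TangentBundle (𝓡 n) M) :=
    inferInstanceAs (IsManifold (𝓡 n).tangent ∞ (TangentBundle (𝓡 n) M))
  filter_upwards [hX, hY] with w hw hw'
  exact ContMDiffAt.mlieBracket_vectorField (n := ⊤) (m := ⊤) hw hw' (by
    rw [minSmoothness_of_isRCLikeNormedField]; rfl)

lemma param_mem_source (hz : z ∈ coordDomain q) :
    param q z ∈ (extChartAt (𝓡 n).tangent q).source := by
  apply (extChartAt (𝓡 n).tangent q).map_target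
  rw [extChartAt_target_eq]
  exact hz

lemma extChartAt_param (hz : z ∈ coordDomain q) :
    extChartAt (𝓡 n).tangent q (param q z) = z := by
  apply (extChartAt (𝓡 n).tangent q).right_inv
  rw [extChartAt_target_eq]
  exact hz

lemma contMDiffAt_extChartAt_param (hz : z ∈ coordDomain q) :
    ContMDiffAt (𝓡 n).tangent 𝓘(ℝ, Model n × Model n) ∞
      (extChartAt (𝓡 n).tangent q) (param q z) := by
  have := param_mem_source hz
  rw [extChartAt_source] at this
  exact contMDiffAt_extChartAt' this

lemma hasMFDerivAt_chart_param (hz : z ∈ coordDomain q) :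
    HasMFDerivAt (𝓡 n).tangent 𝓘(ℝ, Model n × Model n)
      (extChartAt (𝓡 n).tangent q) (param q z) (paramD q z).inverse := by
  have h1 := ((contMDiffAt_extChartAt_param hz).mdifferentiableAt (by simp)).hasMFDerivAt
  have h2 := h1.comp z (hasMFDerivAt_param hz)
  have h3 : HasMFDerivAt 𝓘(ℝ, Model n × Model n) 𝓘(ℝ, Model n × Model n)
      ((extChartAt (𝓡 n).tangent q) ∘ param q) z (ContinuousLinearMap.id ℝ _) := by
    refine (hasMFDerivAt_id z).congr_of_eventuallyEq ?_
    filter_upwards [(isOpen_coordDomain q).mem_nhds hz] with z' hz'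
    exact extChartAt_param hz'
  have h4 := hasMFDerivAt_unique h2 h3
  have h5 : mfderiv (𝓡 n).tangent 𝓘(ℝ, Model n × Model n)
      (extChartAt (𝓡 n).tangent q) (param q z) = (paramD q z).inverse :=
    eq_inverse_of_comp_eq_id (isInvertible_paramD hz) h4
  rwa [h5] at h1

/-- A vector field with smooth components is smooth: it is the pullback, along the chart, of the
vector field `loc q X` on the model space. -/
lemma contMDiffAt_of_loc {X : VField (n := n) M} (hz : z ∈ coordDomain q)
    (h : ContDiffAt ℝ ∞ (loc q X) z) :
    ContMDiffAt (𝓡 n).tangent (𝓡 n).tangent.tangent ∞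
    (fun w => (⟨w, X w⟩ : TangentBundle (𝓡 n).tangent (TangentBundle (𝓡 n) M))) (param q z) := by
  have h1 : ContMDiffAt 𝓘(ℝ, Model n × Model n) 𝓘(ℝ, Model n × Model n).tangent ∞
      (fun z => (⟨z, loc q X z⟩ : TangentBundle 𝓘(ℝ, Model n × Model n) (Model n × Model n))) z :=
    contMDiffAt_vectorSpace_iff_contDiffAt.2 h
  have hinv : ∀ z ∈ coordDomain q, mfderiv (𝓡 n).tangent 𝓘(ℝ, Model n × Model n)
      (extChartAt (𝓡 n).tangent q) (param q z) = (paramD q z).inverse :=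
    fun z hz => (hasMFDerivAt_chart_param hz).mfderiv
  rw [← extChartAt_param hz] at h1
  have h2 := ContMDiffWithinAt.mpullback_vectorField_preimage (n := ∞) (t := Set.univ)
    h1.contMDiffWithinAt (contMDiffAt_extChartAt_param hz) (by
      rw [hinv z hz]
      obtain ⟨e, he⟩ := isInvertible_paramD hz
      rw [← he, ContinuousLinearMap.inverse_equiv]
      exact ⟨e.symm, rfl⟩) (by simp)
  rw [Set.preimage_univ, contMDiffWithinAt_univ] at h2
  refine h2.congr_of_eventuallyEq ?_
  refine eventually_of_param (p := fun w => _ = _) hz ?_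
  filter_upwards [(isOpen_coordDomain q).mem_nhds hz] with z' hz'
  rw [Bundle.TotalSpace.mk_inj]
  have h3 : X (param q z') = (paramD q z').inverse.inverse
      (loc q X (extChartAt (𝓡 n).tangent q (param q z'))) := by
    rw [extChartAt_param hz']
    obtain ⟨e, he⟩ := isInvertible_paramD hz'
    rw [loc, ← he, ContinuousLinearMap.inverse_equiv, ContinuousLinearMap.inverse_equiv]
    simp
  rw [h3, ← hinv z' hz']
  rfl

lemma smoothNear_of_loc {X : VField (n := n) M} (hz : z ∈ coordDomain q)
    (h : ∀ᶠ z' in 𝓝 z, ContDiffAt ℝ ∞ (loc q X) z') : SmoothNear X (param q z) := by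
  refine eventually_of_param hz ?_
  filter_upwards [h, (isOpen_coordDomain q).mem_nhds hz] with z' h' hz'
  exact contMDiffAt_of_loc hz' h'

lemma contMDiffAt_iff_param {g : TangentBundle (𝓡 n) M → ℝ} (hz : z ∈ coordDomain q) :
    ContMDiffAt (𝓡 n).tangent 𝓘(ℝ, ℝ) ∞ g (param q z) ↔
      ContDiffAt ℝ ∞ (fun z => g (param q z)) z := by
  refine ⟨fun h => (h.comp z (contMDiffAt_param hz)).contDiffAt, fun h => ?_⟩
  rw [← extChartAt_param hz] at h
  have := h.contMDiffAt.comp (param q z) (contMDiffAt_extChartAt_param hz)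
  refine this.congr_of_eventuallyEq (eventually_of_param (p := fun w => _ = _) hz ?_)
  filter_upwards [(isOpen_coordDomain q).mem_nhds hz] with z' hz'
  simp only [Function.comp, extChartAt_param hz']

lemma deriveAlong_param {g : TangentBundle (𝓡 n) M → ℝ} (hz : z ∈ coordDomain q)
    (h : DifferentiableAt ℝ (fun z => g (param q z)) z) (X : VField (n := n) M) :
    deriveAlong X g (param q z) = fderiv ℝ (fun z => g (param q z)) z (loc q X z) := by
  have h1 : HasMFDerivAt 𝓘(ℝ, Model n × Model n) 𝓘(ℝ, ℝ) (fun z => g (param q z))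
    (extChartAt (𝓡 n).tangent q (param q z)) (fderiv ℝ (fun z => g (param q z)) z) := by
    rw [extChartAt_param hz]
    exact h.hasFDerivAt.hasMFDerivAt
  have h2 := h1.comp (param q z) (hasMFDerivAt_chart_param hz)
  have h3 : HasMFDerivAt (𝓡 n).tangent 𝓘(ℝ, ℝ) g (param q z)
      ((fderiv ℝ (fun z => g (param q z)) z).comp (paramD q z).inverse) := by
    refine h2.congr_of_eventuallyEq (eventually_of_param (p := fun w => _ = _) hz ?_)
    filter_upwards [(isOpen_coordDomain q).mem_nhds hz] with z' hz'
    simp only [Function.comp, extChartAt_param hz']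
  rw [deriveAlong, mvfderiv, h3.mfderiv]
  rfl

/-- The vector field which has constant components `c` in the chart at `q`. -/
def constField (q : TangentBundle (𝓡 n) M) (c : Model n × Model n) : VField (n := n) M :=
  fun w => (paramD q (extChartAt (𝓡 n).tangent q w) c : Model n × Model n)

lemma loc_constField (hz : z ∈ coordDomain q) (c : Model n × Model n) :
    loc q (constField q c) z = c := by
  apply loc_eq hz
  rw [constField, extChartAt_param hz]

lemma smoothNear_constField (hz : z ∈ coordDomain q) (c : Model n × Model n) :
    SmoothNear (constField q c) (param q z) := by
  refine smoothNear_of_loc hz ?_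
  filter_upwards [(isOpen_coordDomain q).mem_nhds hz] with z' hz'
  refine contDiffAt_const (c := c) |>.congr_of_eventuallyEq ?_
  filter_upwards [(isOpen_coordDomain q).mem_nhds hz'] with z' hz'
  exact loc_constField hz' c

end Basic

end

section

/-! ### Higher derivatives of smooth maps -/

section Derivatives

variable {V W : Type*} [NormedAddCommGroup V] [NormedSpace ℝ V] [NormedAddCommGroup W]
  [NormedSpace ℝ W] {f : V → W} {z : V}

lemma smooth_diff (hf : ContDiffAt ℝ ∞ f z) : DifferentiableAt ℝ f z :=
  hf.differentiableAt (by simp)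

lemma smooth_fderiv (hf : ContDiffAt ℝ ∞ f z) : ContDiffAt ℝ ∞ (fderiv ℝ f) z :=
  hf.fderiv_right (by simp)

lemma second_fderiv_comm (hf : ContDiffAt ℝ ∞ f z) (u v : V) :
    fderiv ℝ (fderiv ℝ f) z u v = fderiv ℝ (fderiv ℝ f) z v u :=
  (hf.isSymmSndFDerivAt (by simpa using ENat.LEInfty.out)).eq u v

lemma third_fderiv_comm (hf : ContDiffAt ℝ ∞ f z) (u v w : V) :
    fderiv ℝ (fderiv ℝ (fderiv ℝ f)) z u v w = fderiv ℝ (fderiv ℝ (fderiv ℝ f)) z u w v := by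
  have h2 : ContDiffAt ℝ 2 f z := hf.of_le ENat.LEInfty.out
  have h : (fun x => fderiv ℝ (fderiv ℝ f) x v w) =ᶠ[𝓝 z]
      fun x => fderiv ℝ (fderiv ℝ f) x w v := by
    filter_upwards [h2.eventually (by simp)] with x hx
    exact (hx.isSymmSndFDerivAt (by simp)).eq v w
  have hd := (smooth_diff (smooth_fderiv (smooth_fderiv hf))).hasFDerivAt
  have h1 : ∀ v w : V, fderiv ℝ (fun x => fderiv ℝ (fderiv ℝ f) x v w) z u =
      fderiv ℝ (fderiv ℝ (fderiv ℝ f)) z u v w := fun v w => by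
    rw [((hd.clm_apply (hasFDerivAt_const v z)).clm_apply (hasFDerivAt_const w z)).fderiv]
    simp
  rw [← h1, h.fderiv_eq, h1]

lemma fderiv_clm_apply_apply {Z : Type*} [NormedAddCommGroup Z] [NormedSpace ℝ Z]
    {L : V → Z →L[ℝ] W} {X : V → Z} (hL : DifferentiableAt ℝ L z) (hX : DifferentiableAt ℝ X z)
    (u : V) : fderiv ℝ (fun w => L w (X w)) z u =
      fderiv ℝ L z u (X z) + L z (fderiv ℝ X z u) := by
  rw [fderiv_clm_apply hL hX]
  simp [add_comm]

lemma fderiv_fderiv_apply (hf : ContDiffAt ℝ ∞ f z) {X : V → V} (hX : DifferentiableAt ℝ X z)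
    (u : V) : fderiv ℝ (fun w => fderiv ℝ f w (X w)) z u =
      fderiv ℝ (fderiv ℝ f) z u (X z) + fderiv ℝ f z (fderiv ℝ X z u) := by
  rw [fderiv_clm_apply_apply (smooth_diff (smooth_fderiv hf)) hX]

lemma fderiv_fderiv_const (hf : ContDiffAt ℝ ∞ f z) (c u : V) :
    fderiv ℝ (fun w => fderiv ℝ f w c) z u = fderiv ℝ (fderiv ℝ f) z u c := by
  rw [fderiv_fderiv_apply hf (differentiableAt_const c)]
  simp

lemma fderiv_eq_of_eqOn {g : V → W} {Ω : Set V} (hΩ : IsOpen Ω) (h : ∀ w ∈ Ω, f w = g w)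
    (hz : z ∈ Ω) : fderiv ℝ f z = fderiv ℝ g z :=
  Filter.EventuallyEq.fderiv_eq (Filter.eventuallyEq_of_mem (hΩ.mem_nhds hz) h)

end Derivatives

/-! ### Sprays on open subsets of `E × E` -/

variable {E : Type*} [NormedAddCommGroup E] [NormedSpace ℝ E]

/-- `f` is smooth on `Ω ⊆ E × E` and positively homogeneous of degree `r` in the second variable,
in the infinitesimal form given by Euler's theorem. -/
structure EulerOn {W : Type*} [NormedAddCommGroup W] [NormedSpace ℝ W] (Ω : Set (E × E)) (r : ℝ)
    (f : E × E → W) : Prop where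
  smooth : ∀ z ∈ Ω, ContDiffAt ℝ ∞ f z
  euler : ∀ z ∈ Ω, fderiv ℝ f z (0, z.2) = r • f z

/-- The nonlinear connection `N = ∂G/∂y` of the spray with coefficients `G`. -/
def conn (G : E × E → E) (z : E × E) : E →L[ℝ] E :=
  (fderiv ℝ G z).comp (ContinuousLinearMap.inr ℝ E E)

/-- The horizontal lift `(a, -N a)` of `a`. -/
def horiz (G : E × E → E) (a : E) (z : E × E) : E × E := (a, -conn G z a)

/-- The spray `y ∂/∂x - 2 G ∂/∂y` with coefficients `G`. -/
def sprayVec (G : E × E → E) (z : E × E) : E × E := (z.2, -((2 : ℝ) • G z))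

/-- The Jacobi endomorphism of the spray with coefficients `G`. -/
def jac (G : E × E → E) (z : E × E) (a : E) : E :=
  (2 : ℝ) • fderiv ℝ G z (a, 0) - fderiv ℝ (fderiv ℝ G) z (sprayVec G z) (0, a)
    - conn G z (conn G z a)

/-- The curvature of the nonlinear connection: the bracket of the horizontal lifts of `a` and `c`
is the vertical lift of `curv G z a c`. -/
def curv (G : E × E → E) (z : E × E) (a c : E) : E :=
  fderiv ℝ (fderiv ℝ G) z (horiz G c z) (0, a) - fderiv ℝ (fderiv ℝ G) z (horiz G a z) (0, c)

/-- The components of `d_h η` for the semi-basic form with components `η`. -/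
def dhForm (G : E × E → E) (η : E × E → E → ℝ) (z : E × E) (a c : E) : ℝ :=
  fderiv ℝ (fun w => η w c) z (horiz G a z) - fderiv ℝ (fun w => η w a) z (horiz G c z)

lemma conn_apply (G : E × E → E) (z : E × E) (a : E) : conn G z a = fderiv ℝ G z (0, a) := rfl

lemma vert_add (a b : E) : ((0 : E), a + b) = (0, a) + (0, b) := by simp
lemma vert_sub (a b : E) : ((0 : E), a - b) = (0, a) - (0, b) := by simp
lemma vert_neg (a : E) : ((0 : E), -a) = -(0, a) := by simp
lemma vert_smul (r : ℝ) (a : E) : ((0 : E), r • a) = r • ((0 : E), a) := by simp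

lemma horiz_eq (G : E × E → E) (a : E) (z : E × E) :
    horiz G a z = (a, 0) - (0, conn G z a) := by simp [horiz]

lemma sprayVec_eq (G : E × E → E) (z : E × E) :
    sprayVec G z = (z.2, 0) - (2 : ℝ) • (0, G z) := by simp [sprayVec]

section Euler

variable {W : Type*} [NormedAddCommGroup W] [NormedSpace ℝ W] {Ω : Set (E × E)} {r : ℝ}
  {f : E × E → W} {z : E × E}

lemma hasFDerivAt_vert (z : E × E) : HasFDerivAt (fun w : E × E => ((0 : E), w.2))
    ((ContinuousLinearMap.inr ℝ E E).comp (ContinuousLinearMap.snd ℝ E E)) z :=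
  ((ContinuousLinearMap.inr ℝ E E).comp (ContinuousLinearMap.snd ℝ E E)).hasFDerivAt

/-- Euler's theorem, differentiated along `u`. -/
lemma EulerOn.second (hf : EulerOn Ω r f) (hΩ : IsOpen Ω) (hz : z ∈ Ω) (u : E × E) :
    fderiv ℝ (fderiv ℝ f) z u (0, z.2) = r • fderiv ℝ f z u - fderiv ℝ f z (0, u.2) := by
  have h1 := fderiv_eq_of_eqOn hΩ hf.euler hz
  have h2 := fderiv_fderiv_apply (hf.smooth z hz) (hasFDerivAt_vert z).differentiableAt u
  rw [h1, (hasFDerivAt_vert z).fderiv,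
    fderiv_fun_const_smul (smooth_diff (hf.smooth z hz))] at h2
  rw [eq_sub_iff_add_eq]
  exact h2.symm

lemma EulerOn.second_vert (hf : EulerOn Ω r f) (hΩ : IsOpen Ω) (hz : z ∈ Ω) (a : E) :
    fderiv ℝ (fderiv ℝ f) z (0, z.2) (0, a) = (r - 1) • fderiv ℝ f z (0, a) := by
  rw [second_fderiv_comm (hf.smooth z hz), hf.second hΩ hz]
  module

/-- A vertical derivative lowers the degree of homogeneity by one. -/
lemma EulerOn.vert (hf : EulerOn Ω r f) (hΩ : IsOpen Ω) (a : E) :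
    EulerOn Ω (r - 1) (fun w => fderiv ℝ f w (0, a)) where
  smooth z hz := (smooth_fderiv (hf.smooth z hz)).clm_apply contDiffAt_const
  euler z hz := by
    rw [fderiv_fderiv_const (hf.smooth z hz), hf.second_vert hΩ hz]

end Euler

section Spray

variable {Ω : Set (E × E)} {G : E × E → E} {z : E × E}

lemma conn_self (hG : EulerOn Ω 2 G) (hz : z ∈ Ω) : conn G z z.2 = (2 : ℝ) • G z :=
  hG.euler z hz

lemma horiz_self (hG : EulerOn Ω 2 G) (hz : z ∈ Ω) : horiz G z.2 z = sprayVec G z := by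
  rw [horiz, conn_self hG hz, sprayVec]

lemma hasFDerivAt_horiz (hG : ContDiffAt ℝ ∞ G z) (a : E) :
    HasFDerivAt (horiz G a)
      (-(ContinuousLinearMap.inr ℝ E E).comp ((fderiv ℝ (fderiv ℝ G) z).flip (0, a))) z := by
  have h : HasFDerivAt (fun w => -(conn G w a)) (-((fderiv ℝ (fderiv ℝ G) z).flip (0, a))) z := by
    have := (smooth_diff (smooth_fderiv hG)).hasFDerivAt.clm_apply
      (hasFDerivAt_const ((0 : E), a) z)
    refine this.neg.congr_fderiv ?_
    ext <;> simp
  refine ((hasFDerivAt_const a z).prodMk h).congr_fderiv ?_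
  ext <;> simp

lemma fderiv_horiz (hG : ContDiffAt ℝ ∞ G z) (a : E) (u : E × E) :
    fderiv ℝ (horiz G a) z u = -(0, fderiv ℝ (fderiv ℝ G) z u (0, a)) := by
  rw [(hasFDerivAt_horiz hG a).fderiv]
  simp

lemma contDiffAt_conn (hG : ContDiffAt ℝ ∞ G z) : ContDiffAt ℝ ∞ (conn G) z :=
  (smooth_fderiv hG).clm_comp contDiffAt_const

lemma contDiffAt_horiz (hG : ContDiffAt ℝ ∞ G z) (a : E) : ContDiffAt ℝ ∞ (horiz G a) z :=
  contDiffAt_const.prodMk ((contDiffAt_conn hG).clm_apply contDiffAt_const).neg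

/-- The derivative of a horizontal derivative. -/
lemma fderiv_fderiv_horiz {W : Type*} [NormedAddCommGroup W] [NormedSpace ℝ W] {f : E × E → W}
    (hG : ContDiffAt ℝ ∞ G z) (hf : ContDiffAt ℝ ∞ f z) (c : E) (u : E × E) :
    fderiv ℝ (fun w => fderiv ℝ f w (horiz G c w)) z u =
      fderiv ℝ (fderiv ℝ f) z u (horiz G c z)
        - fderiv ℝ f z (0, fderiv ℝ (fderiv ℝ G) z u (0, c)) := by
  rw [fderiv_fderiv_apply hf (hasFDerivAt_horiz hG c).differentiableAt, fderiv_horiz hG, map_neg,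
    sub_eq_add_neg]

/-- The commutator of two horizontal derivatives is the derivative along the curvature. -/
lemma horiz_commutator {W : Type*} [NormedAddCommGroup W] [NormedSpace ℝ W] {f : E × E → W}
    (hG : ContDiffAt ℝ ∞ G z) (hf : ContDiffAt ℝ ∞ f z) (a c : E) :
    fderiv ℝ (fun w => fderiv ℝ f w (horiz G c w)) z (horiz G a z)
      - fderiv ℝ (fun w => fderiv ℝ f w (horiz G a w)) z (horiz G c z) =
      fderiv ℝ f z (0, curv G z a c) := by
  rw [fderiv_fderiv_horiz hG hf, fderiv_fderiv_horiz hG hf, curv, vert_sub, map_sub,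
    second_fderiv_comm hf (horiz G a z)]
  abel

lemma hasFDerivAt_sprayVec (hG : ContDiffAt ℝ ∞ G z) :
    HasFDerivAt (sprayVec G)
      ((ContinuousLinearMap.snd ℝ E E).prod (-((2 : ℝ) • fderiv ℝ G z))) z :=
  hasFDerivAt_snd.prodMk ((smooth_diff hG).hasFDerivAt.const_smul (2 : ℝ)).neg

lemma fderiv_sprayVec (hG : ContDiffAt ℝ ∞ G z) (u : E × E) :
    fderiv ℝ (sprayVec G) z u = (u.2, 0) - (2 : ℝ) • (0, fderiv ℝ G z u) := by
  rw [(hasFDerivAt_sprayVec hG).fderiv]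
  simp

lemma contDiffAt_sprayVec (hG : ContDiffAt ℝ ∞ G z) : ContDiffAt ℝ ∞ (sprayVec G) z :=
  contDiffAt_snd.prodMk (contDiffAt_const.smul hG).neg

/-- The derivative of a derivative along the spray. -/
lemma fderiv_fderiv_spray {W : Type*} [NormedAddCommGroup W] [NormedSpace ℝ W] {f : E × E → W}
    (hG : ContDiffAt ℝ ∞ G z) (hf : ContDiffAt ℝ ∞ f z) (u : E × E) :
    fderiv ℝ (fun w => fderiv ℝ f w (sprayVec G w)) z u =
      fderiv ℝ (fderiv ℝ f) z u (sprayVec G z) + fderiv ℝ f z (u.2, 0)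
        - (2 : ℝ) • fderiv ℝ f z (0, fderiv ℝ G z u) := by
  rw [fderiv_fderiv_apply hf (hasFDerivAt_sprayVec hG).differentiableAt, fderiv_sprayVec hG,
    map_sub, map_smul]
  abel

/-- The spray is in the kernel of its Jacobi endomorphism. -/
lemma jac_self (hG : EulerOn Ω 2 G) (hΩ : IsOpen Ω) (hz : z ∈ Ω) : jac G z z.2 = 0 := by
  rw [jac, hG.second hΩ hz, conn_self hG hz, map_smul, sprayVec_eq]
  simp only [map_sub, map_smul, conn_apply, Prod.snd_sub, Prod.smul_snd, zero_sub, vert_neg,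
    vert_smul, map_neg]
  module

/-- The curvature contracted with the position vector is the Jacobi endomorphism. -/
lemma curv_self (hG : EulerOn Ω 2 G) (hΩ : IsOpen Ω) (hz : z ∈ Ω) (c : E) :
    curv G z z.2 c = jac G z c := by
  rw [curv, jac, hG.second hΩ hz, horiz_self hG hz, horiz_eq]
  simp only [map_sub, conn_apply, Prod.snd_sub, zero_sub, vert_neg, map_neg]
  module

lemma fderiv_jac (hG : ContDiffAt ℝ ∞ G z) (a : E) (u : E × E) :
    fderiv ℝ (fun w => jac G w a) z u =
      (2 : ℝ) • fderiv ℝ (fderiv ℝ G) z u (a, 0)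
      - (fderiv ℝ (fderiv ℝ (fderiv ℝ G)) z u (sprayVec G z) (0, a)
        + fderiv ℝ (fderiv ℝ G) z ((u.2, 0) - (2 : ℝ) • (0, fderiv ℝ G z u)) (0, a))
      - (fderiv ℝ (fderiv ℝ G) z u (0, fderiv ℝ G z (0, a))
        + fderiv ℝ G z (0, fderiv ℝ (fderiv ℝ G) z u (0, a))) := by
  have h1 := (smooth_diff (smooth_fderiv hG)).hasFDerivAt
  have h2 := (smooth_diff (smooth_fderiv (smooth_fderiv hG))).hasFDerivAt
  have h3 := ((h1.clm_apply (hasFDerivAt_const ((a, 0) : E × E) z)).const_smul (2 : ℝ)).sub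
    ((h2.clm_apply (hasFDerivAt_sprayVec hG)).clm_apply
      (hasFDerivAt_const ((0, a) : E × E) z))
  have h4 := h1.clm_apply (hasFDerivAt_const ((0, a) : E × E) z)
  have h5 := h1.clm_apply
    (((ContinuousLinearMap.inr ℝ E E).hasFDerivAt (x := fderiv ℝ G z (0, a))).comp z h4)
  have h6 := h3.sub h5
  have h7 : fderiv ℝ (fun w => jac G w a) z = _ := h6.fderiv
  rw [h7]
  simp
  abel

/-- The vertical exterior derivative of the Jacobi endomorphism is three times the curvature. -/
lemma jac_vert_antisymm (hG : ContDiffAt ℝ ∞ G z) (a c : E) :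
    fderiv ℝ (fun w => jac G w c) z (0, a) - fderiv ℝ (fun w => jac G w a) z (0, c) =
      (3 : ℝ) • curv G z a c := by
  have h3 : fderiv ℝ (fderiv ℝ (fderiv ℝ G)) z (0, a) (sprayVec G z) (0, c) =
      fderiv ℝ (fderiv ℝ (fderiv ℝ G)) z (0, c) (sprayVec G z) (0, a) := by
    rw [second_fderiv_comm (smooth_fderiv hG), third_fderiv_comm hG,
      second_fderiv_comm (smooth_fderiv hG)]
  rw [fderiv_jac hG c, fderiv_jac hG a, h3, curv]
  simp only [horiz_eq, map_sub, map_smul, conn_apply, sub_apply,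
    smul_apply]
  rw [second_fderiv_comm hG (0, a) (0, c), second_fderiv_comm hG (0, a) (c, 0),
    second_fderiv_comm hG (0, c) (a, 0), second_fderiv_comm hG (0, a) (0, fderiv ℝ G z (0, c)),
    second_fderiv_comm hG (0, c) (0, fderiv ℝ G z (0, a))]
  module

end Spray

end

section

/-! ### Projective changes of sprays -/

variable {E : Type*} [NormedAddCommGroup E] [NormedSpace ℝ E]

/-- The components of the semi-basic form `d_J (S P) + P d_J P - 3 d_h P`, the coefficient of `-𝒞`
in the change of the Jacobi endomorphism under the projective change with factor `P`. -/
def projForm (G : E × E → E) (P : E × E → ℝ) (z : E × E) (a : E) : ℝ :=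
  fderiv ℝ (fun w => fderiv ℝ P w (sprayVec G w)) z (0, a) + P z * fderiv ℝ P z (0, a)
    - 3 * fderiv ℝ P z (horiz G a z)

section ProjectiveChange

variable {Ω : Set (E × E)} {G G' : E × E → E} {P : E × E → ℝ} {z : E × E}

lemma fderiv_proj (hΩ : IsOpen Ω) (hG : EulerOn Ω 2 G) (hP : EulerOn Ω 1 P)
    (h : ∀ w ∈ Ω, G' w = G w + P w • w.2) (hz : z ∈ Ω) (u : E × E) :
    fderiv ℝ G' z u = fderiv ℝ G z u + (fderiv ℝ P z u • z.2 + P z • u.2) := by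
  have h1 := (smooth_diff (hG.smooth z hz)).hasFDerivAt.add
    ((smooth_diff (hP.smooth z hz)).hasFDerivAt.smul hasFDerivAt_snd)
  rw [fderiv_eq_of_eqOn hΩ h hz]
  have h2 : fderiv ℝ (fun w => G w + P w • w.2) z = _ := h1.fderiv
  rw [h2]
  simp [add_comm]

lemma conn_proj (hΩ : IsOpen Ω) (hG : EulerOn Ω 2 G) (hP : EulerOn Ω 1 P)
    (h : ∀ w ∈ Ω, G' w = G w + P w • w.2) (hz : z ∈ Ω) (a : E) :
    conn G' z a = conn G z a + (fderiv ℝ P z (0, a) • z.2 + P z • a) :=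
  fderiv_proj hΩ hG hP h hz (0, a)

lemma horiz_proj (hΩ : IsOpen Ω) (hG : EulerOn Ω 2 G) (hP : EulerOn Ω 1 P)
    (h : ∀ w ∈ Ω, G' w = G w + P w • w.2) (hz : z ∈ Ω) (a : E) :
    horiz G' a z = horiz G a z - fderiv ℝ P z (0, a) • (0, z.2) - P z • (0, a) := by
  rw [horiz_eq, horiz_eq, conn_proj hΩ hG hP h hz, vert_add, vert_add, vert_smul, vert_smul]
  abel

lemma sprayVec_proj (h : ∀ w ∈ Ω, G' w = G w + P w • w.2) (hz : z ∈ Ω) :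
    sprayVec G' z = sprayVec G z - (2 * P z) • (0, z.2) := by
  rw [sprayVec_eq, sprayVec_eq, h z hz, vert_add, vert_smul]
  module

lemma smooth_proj (hΩ : IsOpen Ω) (hG : EulerOn Ω 2 G) (hP : EulerOn Ω 1 P)
    (h : ∀ w ∈ Ω, G' w = G w + P w • w.2) (hz : z ∈ Ω) : ContDiffAt ℝ ∞ G' z :=
  ((hG.smooth z hz).add ((hP.smooth z hz).smul contDiffAt_snd)).congr_of_eventuallyEq
    (Filter.eventuallyEq_of_mem (hΩ.mem_nhds hz) h)

lemma second_proj (hΩ : IsOpen Ω) (hG : EulerOn Ω 2 G) (hP : EulerOn Ω 1 P)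
    (h : ∀ w ∈ Ω, G' w = G w + P w • w.2) (hz : z ∈ Ω) (u : E × E) (a : E) :
    fderiv ℝ (fderiv ℝ G') z u (0, a) = fderiv ℝ (fderiv ℝ G) z u (0, a)
      + (fderiv ℝ (fderiv ℝ P) z u (0, a) • z.2 + fderiv ℝ P z (0, a) • u.2
        + fderiv ℝ P z u • a) := by
  rw [← fderiv_fderiv_const (smooth_proj hΩ hG hP h hz),
    fderiv_eq_of_eqOn hΩ (fun w hw => fderiv_proj hΩ hG hP h hw (0, a)) hz]
  have hg := (smooth_diff (smooth_fderiv (hG.smooth z hz))).hasFDerivAt.clm_apply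
    (hasFDerivAt_const ((0, a) : E × E) z)
  have hp := (smooth_diff (smooth_fderiv (hP.smooth z hz))).hasFDerivAt.clm_apply
    (hasFDerivAt_const ((0, a) : E × E) z)
  have hp' := (smooth_diff (hP.smooth z hz)).hasFDerivAt
  have h1 := hg.add ((hp.smul hasFDerivAt_snd).add (hp'.smul (hasFDerivAt_const a z)))
  have h2 : fderiv ℝ (fun w => fderiv ℝ G w (0, a) + (fderiv ℝ P w (0, a) • w.2 + P w • a)) z = _ :=
    h1.fderiv
  rw [h2]
  simp
  abel

/-- The Jacobi endomorphism of a projectively changed spray. -/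
lemma jac_proj (hΩ : IsOpen Ω) (hG : EulerOn Ω 2 G) (hP : EulerOn Ω 1 P)
    (h : ∀ w ∈ Ω, G' w = G w + P w • w.2) (hz : z ∈ Ω) (a : E) :
    jac G' z a = jac G z a + (P z ^ 2 - fderiv ℝ P z (sprayVec G z)) • a
      - projForm G P z a • z.2 := by
  have e1 : fderiv ℝ (fderiv ℝ P) z (0, a) (sprayVec G z)
    = fderiv ℝ (fderiv ℝ P) z (sprayVec G z) (0, a) := second_fderiv_comm (hP.smooth z hz) _ _
  have e2 := hG.second_vert hΩ hz a
  have e3 := hP.second_vert hΩ hz a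
  have e4 := hP.euler z hz
  have e5 := hG.euler z hz
  rw [projForm, fderiv_fderiv_spray (hG.smooth z hz) (hP.smooth z hz), e1, jac, jac,
    conn_proj hΩ hG hP h hz, conn_proj hΩ hG hP h hz, second_proj hΩ hG hP h hz,
    fderiv_proj hΩ hG hP h hz, sprayVec_proj h hz, horiz_eq]
  simp only [map_add, map_sub, map_smul, conn_apply, vert_add, vert_smul, sub_apply, smul_apply,
    e2, e3, e4, e5]
  simp only [sprayVec, Prod.snd_sub, Prod.smul_snd, smul_eq_mul]
  module

/-- Projective invariance of `d_h ξ`, for the curvature form `ξ` of an isotropic spray. The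
commutator of two horizontal derivatives of `P`, which `d_h d_h P` produces, is the derivative of
`P` along the curvature; as `ξ` determines the curvature (`hcurv`), it cancels the terms which come
from the difference of the two horizontal projectors. -/
lemma dhForm_proj (hΩ : IsOpen Ω) (hG : EulerOn Ω 2 G) (hP : EulerOn Ω 1 P)
    (h : ∀ w ∈ Ω, G' w = G w + P w • w.2) {ξ ξ' : E × E → E → ℝ}
    (hξ : ∀ c, EulerOn Ω 1 (fun w => ξ w c))
    (hξ' : ∀ w ∈ Ω, ∀ c, ξ' w c =
      ξ w c + (P w * fderiv ℝ P w (0, c) - fderiv ℝ P w (horiz G c w)))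
    (hcurv : ∀ w ∈ Ω, ∀ a c, curv G w a c = ξ w a • c - ξ w c • a
      - (fderiv ℝ (fun w => ξ w c) w (0, a) - fderiv ℝ (fun w => ξ w a) w (0, c)) • w.2)
    (hz : z ∈ Ω) (a c : E) : dhForm G' ξ' z a c = dhForm G ξ z a c := by
  have hGz := hG.smooth z hz
  have hPz := hP.smooth z hz
  -- the derivative of a component of `ξ'`
  have key : ∀ (c : E) (u : E × E), fderiv ℝ (fun w => ξ' w c) z u =
      fderiv ℝ (fun w => ξ w c) z u + (P z * fderiv ℝ (fderiv ℝ P) z u (0, c)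
        + fderiv ℝ P z u * fderiv ℝ P z (0, c)
        - fderiv ℝ (fun w => fderiv ℝ P w (horiz G c w)) z u) := by
    intro c u
    rw [fderiv_eq_of_eqOn hΩ (fun w hw => hξ' w hw c) hz]
    have hp := (smooth_diff (smooth_fderiv hPz)).hasFDerivAt.clm_apply
      (hasFDerivAt_const ((0, c) : E × E) z)
    have hh : DifferentiableAt ℝ (fun w => fderiv ℝ P w (horiz G c w)) z :=
      smooth_diff ((smooth_fderiv hPz).clm_apply (contDiffAt_horiz hGz c))
    have h1 := (smooth_diff ((hξ c).smooth z hz)).hasFDerivAt.add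
      (((smooth_diff hPz).hasFDerivAt.mul hp).sub hh.hasFDerivAt)
    have h2 : fderiv ℝ (fun w => ξ w c + (P w * fderiv ℝ P w (0, c)
      - fderiv ℝ P w (horiz G c w))) z = _ := h1.fderiv
    rw [h2]
    simp
    ring
  have hcomm := horiz_commutator hGz hPz a c
  rw [hcurv z hz] at hcomm
  simp only [vert_sub, vert_smul, map_sub, map_smul, hP.euler z hz, smul_eq_mul] at hcomm
  have hv : ∀ a c : E, fderiv ℝ (fun w => fderiv ℝ P w (horiz G c w)) z (0, a) =
      fderiv ℝ (fderiv ℝ P) z (horiz G c z) (0, a)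
        - fderiv ℝ P z (0, fderiv ℝ (fderiv ℝ G) z (0, a) (0, c)) := fun a c => by
    rw [fderiv_fderiv_horiz hGz hPz, second_fderiv_comm hPz]
  have hy : ∀ c : E, fderiv ℝ (fun w => fderiv ℝ P w (horiz G c w)) z (0, z.2) =
      fderiv ℝ P z (horiz G c z) := fun c => by
    rw [fderiv_fderiv_horiz hGz hPz, second_fderiv_comm hPz, hP.second hΩ hz,
      hG.second_vert hΩ hz]
    simp only [horiz, conn_apply, vert_neg, map_neg, vert_smul, map_smul, smul_eq_mul]
    ring
  have hs1 := second_fderiv_comm hPz (0, a) (0, c)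
  have hs2 := second_fderiv_comm hGz (0, a) (0, c)
  simp only [dhForm, key, horiz_proj hΩ hG hP h hz, map_sub, map_smul, sub_apply, smul_apply,
    smul_eq_mul, hy, (hξ _).euler z hz]
  have hyP : ∀ c : E, fderiv ℝ (fderiv ℝ P) z (0, z.2) (0, c) = 0 := fun c => by
    rw [hP.second_vert hΩ hz, sub_self, zero_smul]
  simp only [hv, hs1, hs2, hyP]
  linear_combination (-1 : ℝ) * hcomm

end ProjectiveChange

/-! ### Isotropic sprays -/

section Isotropic

variable {Ω : Set (E × E)} {G : E × E → E} {z : E × E}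

/-- The Jacobi endomorphism has the form `ρ Id - α ⊗ y` on `Ω`, with smooth `ρ` and `α`. -/
structure IsoOn (Ω : Set (E × E)) (G : E × E → E) (ρ : E × E → ℝ) (α : E × E → E → ℝ) : Prop where
  smooth_ricci : ∀ z ∈ Ω, ContDiffAt ℝ ∞ ρ z
  smooth_form : ∀ a, ∀ z ∈ Ω, ContDiffAt ℝ ∞ (fun w => α w a) z
  jac : ∀ z ∈ Ω, ∀ a, jac G z a = ρ z • a - α z a • z.2

/-- `E` has dimension greater than one, in the form: no line exhausts `E`. -/
def NotLine (E : Type*) [NormedAddCommGroup E] [NormedSpace ℝ E] : Prop :=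
  ∀ y : E, ∃ c : E, ∀ s : ℝ, c ≠ s • y

/-- In dimension greater than one, `r Id = s ⊗ y` forces `r = 0` and `s = 0`. -/
lemma NotLine.eq_zero (hE : NotLine E) {r : ℝ} {s : E → ℝ} {y : E} (hy : y ≠ 0)
    (h : ∀ c, r • c = s c • y) : r = 0 ∧ ∀ c, s c = 0 := by
  have hr : r = 0 := by
    by_contra hr
    obtain ⟨c, hc⟩ := hE y
    apply hc (r⁻¹ * s c)
    rw [mul_smul, ← h, smul_smul, inv_mul_cancel₀ hr, one_smul]
  refine ⟨hr, fun c => ?_⟩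
  have := h c
  rw [hr, zero_smul] at this
  exact (smul_eq_zero.1 this.symm).resolve_right hy

/-- The Ricci scalar and the form `α` of an isotropic spray are unique. -/
lemma IsoOn.unique (hE : NotLine E) (h0 : ∀ w ∈ Ω, w.2 ≠ 0) {ρ ρ' : E × E → ℝ}
    {α α' : E × E → E → ℝ} (h : IsoOn Ω G ρ α) (h' : IsoOn Ω G ρ' α') (hz : z ∈ Ω) :
    ρ z = ρ' z ∧ ∀ a, α z a = α' z a := by
  have := hE.eq_zero (r := ρ z - ρ' z) (s := fun a => α z a - α' z a) (h0 z hz) (fun c => by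
    have e := (h.jac z hz c).symm.trans (h'.jac z hz c)
    rw [sub_smul, sub_smul, sub_eq_sub_iff_add_eq_add, add_comm]
    rw [sub_eq_sub_iff_add_eq_add] at e
    rw [add_comm, e, add_comm])
  exact ⟨sub_eq_zero.1 this.1, fun a => sub_eq_zero.1 (this.2 a)⟩

/-- The Jacobi endomorphism as a continuous linear map. -/
def jacL (G : E × E → E) (z : E × E) : E →L[ℝ] E :=
  (2 : ℝ) • (fderiv ℝ G z).comp (ContinuousLinearMap.inl ℝ E E)
    - (fderiv ℝ (fderiv ℝ G) z (sprayVec G z)).comp (ContinuousLinearMap.inr ℝ E E)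
    - (conn G z).comp (conn G z)

lemma contDiffAt_jacL (hG : ContDiffAt ℝ ∞ G z) : ContDiffAt ℝ ∞ (jacL G) z := by
  have h1 : ContDiffAt ℝ ∞ (fun z => (2 : ℝ) • (fderiv ℝ G z).comp
      (ContinuousLinearMap.inl ℝ E E)) z :=
    ((smooth_fderiv hG).clm_comp contDiffAt_const).const_smul (2 : ℝ)
  have h2 : ContDiffAt ℝ ∞ (fun z => (fderiv ℝ (fderiv ℝ G) z (sprayVec G z)).comp
      (ContinuousLinearMap.inr ℝ E E)) z :=
    ((smooth_fderiv (smooth_fderiv hG)).clm_apply (contDiffAt_sprayVec hG)).clm_comp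
      contDiffAt_const
  have h3 : ContDiffAt ℝ ∞ (fun z => (conn G z).comp (conn G z)) z :=
    (contDiffAt_conn hG).clm_comp (contDiffAt_conn hG)
  exact (h1.sub h2).sub h3

/-- The Jacobi endomorphism is homogeneous of degree two. -/
lemma jac_euler (hΩ : IsOpen Ω) (hG : EulerOn Ω 2 G) (hz : z ∈ Ω) (c : E) :
    fderiv ℝ (fun w => jac G w c) z (0, z.2) = (2 : ℝ) • jac G z c := by
  have hGz := hG.smooth z hz
  have h1 := jac_vert_antisymm hGz z.2 c
  rw [curv_self hG hΩ hz] at h1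
  -- differentiate `Φ(y) = 0` along `c`
  have h2 : fderiv ℝ (fun w : E × E => jac G w w.2) z (0, c) = 0 := by
    rw [fderiv_eq_of_eqOn hΩ (g := fun _ => 0) (fun w hw => jac_self hG hΩ hw) hz]
    simp
  have hJ : DifferentiableAt ℝ (jacL G) z := smooth_diff (contDiffAt_jacL hGz)
  have h4 : fderiv ℝ (fun w : E × E => jac G w w.2) z (0, c)
      = fderiv ℝ (jacL G) z (0, c) z.2 + jacL G z (fderiv ℝ Prod.snd z ((0, c) : E × E)) :=
    fderiv_clm_apply_apply hJ differentiableAt_snd _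
  have h5 : fderiv ℝ (fun w : E × E => jac G w z.2) z (0, c) = fderiv ℝ (jacL G) z (0, c) z.2
      + jacL G z (fderiv ℝ (fun _ : E × E => z.2) z (0, c)) :=
    fderiv_clm_apply_apply hJ (differentiableAt_const z.2) _
  rw [h4, fderiv_snd, ContinuousLinearMap.coe_snd'] at h2
  rw [h5, fderiv_fun_const, Pi.zero_apply, zero_apply, map_zero, add_zero] at h1
  have h6 : jacL G z c = jac G z c := rfl
  rw [h6] at h2
  rw [sub_eq_iff_eq_add.1 h1, eq_neg_of_add_eq_zero_left h2]
  module

/-- The Ricci scalar and the form `α` inherit the homogeneity of the Jacobi endomorphism. -/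
lemma IsoOn.euler (hE : NotLine E) (h0 : ∀ w ∈ Ω, w.2 ≠ 0) (hΩ : IsOpen Ω) (hG : EulerOn Ω 2 G)
    {ρ : E × E → ℝ} {α : E × E → E → ℝ} (h : IsoOn Ω G ρ α) :
    EulerOn Ω 2 ρ ∧ ∀ c, EulerOn Ω 1 (fun w => α w c) := by
  have key : ∀ z ∈ Ω, fderiv ℝ ρ z (0, z.2) - 2 * ρ z = 0 ∧
      ∀ c, fderiv ℝ (fun w => α w c) z (0, z.2) - α z c = 0 := by
    intro z hz
    refine hE.eq_zero (h0 z hz) fun c => ?_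
    have h1 := jac_euler hΩ hG hz c
    rw [h.jac z hz, fderiv_eq_of_eqOn hΩ (fun w hw => h.jac w hw c) hz] at h1
    have h2 := ((smooth_diff (h.smooth_ricci z hz)).hasFDerivAt.smul (hasFDerivAt_const c z)).sub
      ((smooth_diff (h.smooth_form c z hz)).hasFDerivAt.smul hasFDerivAt_snd)
    have h3 : fderiv ℝ (fun w => ρ w • c - α w c • w.2) z = _ := h2.fderiv
    rw [h3] at h1
    simp at h1
    refine sub_eq_zero.1 (Eq.trans ?_ (sub_eq_zero.2 h1))
    module
  exact ⟨⟨h.smooth_ricci, fun z hz => sub_eq_zero.1 (key z hz).1⟩, fun c =>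
    ⟨h.smooth_form c, fun z hz => by rw [one_smul]; exact sub_eq_zero.1 ((key z hz).2 c)⟩⟩

/-- The components `(α + d_J ρ) / 3` of the curvature form. -/
def curvForm (ρ : E × E → ℝ) (α : E × E → E → ℝ) (z : E × E) (a : E) : ℝ :=
  (1 / 3) * (α z a + fderiv ℝ ρ z (0, a))

lemma IsoOn.curvForm_euler (hE : NotLine E) (h0 : ∀ w ∈ Ω, w.2 ≠ 0) (hΩ : IsOpen Ω)
    (hG : EulerOn Ω 2 G) {ρ : E × E → ℝ} {α : E × E → E → ℝ} (h : IsoOn Ω G ρ α) (c : E) :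
    EulerOn Ω 1 (fun w => curvForm ρ α w c) := by
  obtain ⟨h1, h2⟩ := h.euler hE h0 hΩ hG
  have h3 := h1.vert hΩ c
  have h4 := h2 c
  refine ⟨fun z hz => contDiffAt_const.mul ((h4.smooth z hz).add (h3.smooth z hz)),
    fun z hz => ?_⟩
  have h5 := ((smooth_diff (h4.smooth z hz)).hasFDerivAt.add
    (smooth_diff (h3.smooth z hz)).hasFDerivAt).const_mul (1 / 3 : ℝ)
  have h6 : fderiv ℝ (fun w => curvForm ρ α w c) z = _ := h5.fderiv
  have e3 := h3.euler z hz
  have e4 := h4.euler z hz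
  rw [h6]
  simp only [smul_apply, add_apply, e3, e4, curvForm, smul_eq_mul]
  ring

/-- The curvature of the nonlinear connection of an isotropic spray is `ξ ∧ J - d_J ξ ⊗ 𝒞`. -/
lemma IsoOn.curv (hΩ : IsOpen Ω) (hG : EulerOn Ω 2 G) {ρ : E × E → ℝ} {α : E × E → E → ℝ}
    (h : IsoOn Ω G ρ α) (hz : z ∈ Ω) (a c : E) :
    curv G z a c = curvForm ρ α z a • c - curvForm ρ α z c • a
      - (fderiv ℝ (fun w => curvForm ρ α w c) z (0, a)
        - fderiv ℝ (fun w => curvForm ρ α w a) z (0, c)) • z.2 := by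
  have h1 := jac_vert_antisymm (hG.smooth z hz) a c
  have h2 : ∀ c u, fderiv ℝ (fun w => SprayGeometry.jac G w c) z u =
      fderiv ℝ ρ z u • c - (fderiv ℝ (fun w => α w c) z u • z.2 + α z c • u.2) := by
    intro c u
    rw [fderiv_eq_of_eqOn hΩ (fun w hw => h.jac w hw c) hz]
    have h2 := ((smooth_diff (h.smooth_ricci z hz)).hasFDerivAt.smul (hasFDerivAt_const c z)).sub
      ((smooth_diff (h.smooth_form c z hz)).hasFDerivAt.smul hasFDerivAt_snd)
    have h3 : fderiv ℝ (fun w => ρ w • c - α w c • w.2) z = _ := h2.fderiv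
    rw [h3]
    simp [add_comm]
  have h3 : ∀ c u, fderiv ℝ (fun w => curvForm ρ α w c) z u =
      (1 / 3) * (fderiv ℝ (fun w => α w c) z u + fderiv ℝ (fderiv ℝ ρ) z u (0, c)) := by
    intro c u
    have hp := (smooth_diff (smooth_fderiv (h.smooth_ricci z hz))).hasFDerivAt.clm_apply
      (hasFDerivAt_const ((0, c) : E × E) z)
    have h5 := ((smooth_diff (h.smooth_form c z hz)).hasFDerivAt.add hp).const_mul (1 / 3 : ℝ)
    have h6 : fderiv ℝ (fun w => curvForm ρ α w c) z = _ := h5.fderiv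
    rw [h6]
    simp
    ring
  have hs := second_fderiv_comm (h.smooth_ricci z hz) (0, a) (0, c)
  rw [h2, h2] at h1
  have h4 : SprayGeometry.curv G z a c = (1 / 3 : ℝ) • ((3 : ℝ) • SprayGeometry.curv G z a c) := by
    rw [smul_smul]; norm_num
  rw [h4, ← h1, h3, h3, hs, curvForm, curvForm]
  module

end Isotropic

end

section

variable {E : Type*} [NormedAddCommGroup E] [NormedSpace ℝ E]

/-! ### Hamel functions -/

section Hamel

variable {Ω : Set (E × E)} {G G' : E × E → E} {P : E × E → ℝ} {z : E × E}

lemma dhForm_dJ (hP : ContDiffAt ℝ ∞ P z) (a c : E) :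
    dhForm G (fun w a => fderiv ℝ P w (0, a)) z a c =
      fderiv ℝ (fderiv ℝ P) z (horiz G a z) (0, c)
        - fderiv ℝ (fderiv ℝ P) z (horiz G c z) (0, a) := by
  rw [dhForm, fderiv_fderiv_const hP, fderiv_fderiv_const hP]

/-- `d_h d_J P` is not changed by the projective change with factor `P`. -/
lemma dhForm_dJ_proj (hΩ : IsOpen Ω) (hG : EulerOn Ω 2 G) (hP : EulerOn Ω 1 P)
    (h : ∀ w ∈ Ω, G' w = G w + P w • w.2) (hz : z ∈ Ω) (a c : E) :
    dhForm G' (fun w a => fderiv ℝ P w (0, a)) z a c =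
      dhForm G (fun w a => fderiv ℝ P w (0, a)) z a c := by
  have hyP : ∀ c : E, fderiv ℝ (fderiv ℝ P) z (0, z.2) (0, c) = 0 := fun c => by
    rw [hP.second_vert hΩ hz, sub_self, zero_smul]
  have hs := second_fderiv_comm (hP.smooth z hz) (0, a) (0, c)
  rw [dhForm_dJ (hP.smooth z hz),
    dhForm_dJ (hP.smooth z hz), horiz_proj hΩ hG hP h hz,
    horiz_proj hΩ hG hP h hz]
  simp only [map_sub, map_smul, sub_apply, smul_apply, hyP, hs, smul_eq_mul]
  ring

/-- A `1`-homogeneous function `P` is a Hamel function if and only if `d_J (S P) = 2 d_h P`. -/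
lemma hamel_iff (hΩ : IsOpen Ω) (hG : EulerOn Ω 2 G) (hP : EulerOn Ω 1 P) :
    (∀ z ∈ Ω, ∀ a c, dhForm G (fun w a => fderiv ℝ P w (0, a)) z a c = 0) ↔
      ∀ z ∈ Ω, ∀ a, fderiv ℝ (fun w => fderiv ℝ P w (sprayVec G w)) z (0, a) =
        2 * fderiv ℝ P z (horiz G a z) := by
  constructor
  · intro h z hz c
    have hPz := hP.smooth z hz
    have h1 := h z hz z.2 c
    rw [dhForm_dJ hPz, horiz_self hG hz, hP.second hΩ hz,
      second_fderiv_comm hPz] at h1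
    rw [fderiv_fderiv_spray (hG.smooth z hz) hPz, sub_eq_zero.1 h1]
    simp only [horiz_eq, map_sub, conn_apply, Prod.snd_sub, zero_sub, vert_neg, map_neg,
      smul_eq_mul]
    ring
  · intro h z hz a c
    have hGz := hG.smooth z hz
    have hPz := hP.smooth z hz
    have hQ : ContDiffAt ℝ ∞ (fun w => fderiv ℝ P w (sprayVec G w)) z :=
      (smooth_fderiv hPz).clm_apply (contDiffAt_sprayVec hGz)
    have key : ∀ a u, fderiv ℝ (fderiv ℝ (fun w => fderiv ℝ P w (sprayVec G w))) z u (0, a) =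
        2 * (fderiv ℝ (fderiv ℝ P) z u (horiz G a z)
          - fderiv ℝ P z (0, fderiv ℝ (fderiv ℝ G) z u (0, a))) := by
      intro a u
      have hd : DifferentiableAt ℝ (fun w => fderiv ℝ P w (horiz G a w)) z :=
        smooth_diff ((smooth_fderiv hPz).clm_apply (contDiffAt_horiz hGz a))
      rw [← fderiv_fderiv_const hQ, fderiv_eq_of_eqOn hΩ (fun w hw => h w hw a) hz,
        fderiv_const_mul hd, smul_apply, fderiv_fderiv_horiz hGz hPz, smul_eq_mul]
    have h1 := second_fderiv_comm hQ (0, a) (0, c)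
    rw [key, key, second_fderiv_comm hGz (0, a) (0, c)] at h1
    rw [dhForm_dJ hPz, second_fderiv_comm hPz, second_fderiv_comm hPz (horiz G c z)]
    linarith

end Hamel

/-! ### Geodesic sprays of Finsler metrics -/

section Finsler

variable {Ω : Set (E × E)} {G : E × E → E} {L : E × E → ℝ} {z : E × E}

/-- The spray with coefficients `G` satisfies the Euler-Lagrange equations of `L`. -/
def EulerLagrange (Ω : Set (E × E)) (G : E × E → E) (L : E × E → ℝ) : Prop :=
  ∀ z ∈ Ω, ∀ a, fderiv ℝ (fderiv ℝ L) z (sprayVec G z) (0, a) = fderiv ℝ L z (a, 0)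

/-- The energy is constant along the spray. -/
lemma EulerLagrange.spray (h : EulerLagrange Ω G L) (hΩ : IsOpen Ω) (hL : EulerOn Ω 2 L)
    (hz : z ∈ Ω) : fderiv ℝ L z (sprayVec G z) = 0 := by
  have h1 := h z hz z.2
  rw [hL.second hΩ hz] at h1
  simp only [sprayVec_eq, map_sub, map_smul, Prod.snd_sub, Prod.smul_snd, zero_sub, vert_neg,
    vert_smul, map_neg, smul_eq_mul] at h1 ⊢
  linarith

/-- The energy is constant along horizontal curves: differentiate `S L = 0` vertically. -/
lemma EulerLagrange.horiz (h : EulerLagrange Ω G L) (hΩ : IsOpen Ω) (hG : EulerOn Ω 2 G)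
    (hL : EulerOn Ω 2 L) (hz : z ∈ Ω) (a : E) : fderiv ℝ L z (horiz G a z) = 0 := by
  have h1 := fderiv_fderiv_spray (hG.smooth z hz) (hL.smooth z hz) (0, a)
  rw [fderiv_eq_of_eqOn hΩ (g := fun _ => 0) (fun w hw => h.spray hΩ hL hw) hz,
    second_fderiv_comm (hL.smooth z hz), h z hz] at h1
  simp only [fderiv_fun_const, Pi.zero_apply, zero_apply, smul_eq_mul] at h1
  rw [horiz_eq, map_sub, conn_apply]
  linarith

/-- The energy is constant along the image of the Jacobi endomorphism, since this image is spanned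
by brackets of horizontal fields. -/
lemma EulerLagrange.jac (h : EulerLagrange Ω G L) (hΩ : IsOpen Ω) (hG : EulerOn Ω 2 G)
    (hL : EulerOn Ω 2 L) (hz : z ∈ Ω) (c : E) : fderiv ℝ L z (0, jac G z c) = 0 := by
  have h1 := horiz_commutator (hG.smooth z hz) (hL.smooth z hz) z.2 c
  rw [curv_self hG hΩ hz] at h1
  rw [← h1, fderiv_eq_of_eqOn hΩ (g := fun _ => 0) (fun w hw => h.horiz hΩ hG hL hw c) hz,
    fderiv_eq_of_eqOn hΩ (g := fun _ => 0) (fun w hw => h.horiz hΩ hG hL hw z.2) hz]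
  simp

/-- `d_h d_J L = 0`. -/
lemma EulerLagrange.dhForm (h : EulerLagrange Ω G L) (hΩ : IsOpen Ω) (hG : EulerOn Ω 2 G)
    (hL : EulerOn Ω 2 L) (hz : z ∈ Ω) (a c : E) :
    fderiv ℝ (fderiv ℝ L) z (SprayGeometry.horiz G a z) (0, c) =
      fderiv ℝ (fderiv ℝ L) z (SprayGeometry.horiz G c z) (0, a) := by
  have key : ∀ a c, fderiv ℝ (fderiv ℝ L) z (SprayGeometry.horiz G c z) (0, a) =
      fderiv ℝ L z (0, fderiv ℝ (fderiv ℝ G) z (0, a) (0, c)) := by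
    intro a c
    have h1 := fderiv_fderiv_horiz (hG.smooth z hz) (hL.smooth z hz) c (0, a)
    rw [fderiv_eq_of_eqOn hΩ (g := fun _ => 0) (fun w hw => h.horiz hΩ hG hL hw c) hz,
      second_fderiv_comm (hL.smooth z hz)] at h1
    simp only [fderiv_fun_const, Pi.zero_apply, zero_apply] at h1
    linarith
  rw [key, key, second_fderiv_comm (hG.smooth z hz)]

/-- The Jacobi endomorphism of the geodesic spray of the metric with energy `L = F²` is
`κ (F² J - F d_J F ⊗ 𝒞)`. -/
def ConstFlag (Ω : Set (E × E)) (G : E × E → E) (L : E × E → ℝ) (κ : ℝ) : Prop :=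
  ∀ z ∈ Ω, ∀ a, jac G z a = (κ * L z) • a - (κ / 2 * fderiv ℝ L z (0, a)) • z.2

lemma ConstFlag.isoOn {κ : ℝ} (h : ConstFlag Ω G L κ) (hL : EulerOn Ω 2 L) :
    IsoOn Ω G (fun w => κ * L w) (fun w a => κ / 2 * fderiv ℝ L w (0, a)) where
  smooth_ricci z hz := contDiffAt_const.mul (hL.smooth z hz)
  smooth_form _ z hz := contDiffAt_const.mul
    ((smooth_fderiv (hL.smooth z hz)).clm_apply contDiffAt_const)
  jac := h

end Finsler

/-! ### Constant flag curvature and projective changes -/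

section ConstantFlagCurvature

variable {Ω : Set (E × E)} {G G' : E × E → E} {P L L' : E × E → ℝ} {z : E × E}

/-- The Ricci scalar of the projectively changed spray. -/
def projRicci (G : E × E → E) (P ρ : E × E → ℝ) (z : E × E) : ℝ :=
  ρ z + (P z ^ 2 - fderiv ℝ P z (sprayVec G z))

lemma contDiffAt_projForm (hG : ContDiffAt ℝ ∞ G z) (hP : ContDiffAt ℝ ∞ P z) (a : E) :
    ContDiffAt ℝ ∞ (fun w => projForm G P w a) z := by
  have hQ : ContDiffAt ℝ ∞ (fun w => fderiv ℝ P w (sprayVec G w)) z :=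
    (smooth_fderiv hP).clm_apply (contDiffAt_sprayVec hG)
  have h1 := (smooth_fderiv hQ).clm_apply (contDiffAt_const (c := ((0 : E), a)))
  have h2 := (smooth_fderiv hP).clm_apply (contDiffAt_const (c := ((0 : E), a)))
  have h3 := (smooth_fderiv hP).clm_apply (contDiffAt_horiz hG a)
  exact (h1.add (hP.mul h2)).sub (contDiffAt_const.mul h3)

lemma contDiffAt_projRicci {ρ : E × E → ℝ} (hG : ContDiffAt ℝ ∞ G z) (hP : ContDiffAt ℝ ∞ P z)
    (hρ : ContDiffAt ℝ ∞ ρ z) : ContDiffAt ℝ ∞ (projRicci G P ρ) z :=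
  hρ.add ((hP.pow 2).sub ((smooth_fderiv hP).clm_apply (contDiffAt_sprayVec hG)))

/-- Projective changes preserve isotropy. -/
lemma IsoOn.proj (hΩ : IsOpen Ω) (hG : EulerOn Ω 2 G) (hP : EulerOn Ω 1 P)
    (h : ∀ w ∈ Ω, G' w = G w + P w • w.2) {ρ : E × E → ℝ} {α : E × E → E → ℝ}
    (hI : IsoOn Ω G ρ α) :
    IsoOn Ω G' (projRicci G P ρ) (fun w a => α w a + projForm G P w a) where
  smooth_ricci z hz := contDiffAt_projRicci (hG.smooth z hz) (hP.smooth z hz)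
    (hI.smooth_ricci z hz)
  smooth_form a z hz := (hI.smooth_form a z hz).add
    (contDiffAt_projForm (hG.smooth z hz) (hP.smooth z hz) a)
  jac z hz a := by
    rw [jac_proj hΩ hG hP h hz, hI.jac z hz, projRicci]
    module

lemma fderiv_projRicci {ρ : E × E → ℝ} (hG : ContDiffAt ℝ ∞ G z) (hP : ContDiffAt ℝ ∞ P z)
    (hρ : ContDiffAt ℝ ∞ ρ z) (u : E × E) :
    fderiv ℝ (projRicci G P ρ) z u = fderiv ℝ ρ z u + (2 * P z * fderiv ℝ P z u
      - fderiv ℝ (fun w => fderiv ℝ P w (sprayVec G w)) z u) := by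
  have hQ : ContDiffAt ℝ ∞ (fun w => fderiv ℝ P w (sprayVec G w)) z :=
    (smooth_fderiv hP).clm_apply (contDiffAt_sprayVec hG)
  have h1 := (smooth_diff hρ).hasFDerivAt.add
    (((smooth_diff hP).hasFDerivAt.pow 2).sub (smooth_diff hQ).hasFDerivAt)
  have h2 : fderiv ℝ (projRicci G P ρ) z = _ := h1.fderiv
  rw [h2]
  simp

/-- The curvature form of the projectively changed spray is `ξ + P d_J P - d_h P`. -/
lemma curvForm_proj {ρ : E × E → ℝ} {α : E × E → E → ℝ} (hG : ContDiffAt ℝ ∞ G z)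
    (hP : ContDiffAt ℝ ∞ P z) (hρ : ContDiffAt ℝ ∞ ρ z) (a : E) :
    curvForm (projRicci G P ρ) (fun w a => α w a + projForm G P w a) z a =
      curvForm ρ α z a + (P z * fderiv ℝ P z (0, a) - fderiv ℝ P z (horiz G a z)) := by
  rw [curvForm, curvForm, fderiv_projRicci hG hP hρ, projForm]
  ring

/-- If two projectively related Finsler metrics have constant flag curvature, then the projective
factor is a Hamel function. -/
lemma ConstFlag.hamel (hE : NotLine E) (h0 : ∀ w ∈ Ω, w.2 ≠ 0) (hΩ : IsOpen Ω)
    (hG : EulerOn Ω 2 G) (hP : EulerOn Ω 1 P) (h : ∀ w ∈ Ω, G' w = G w + P w • w.2)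
    (hL : EulerOn Ω 2 L) (hL' : EulerOn Ω 2 L') {κ κ' : ℝ} (hκ : ConstFlag Ω G L κ)
    (hκ' : ConstFlag Ω G' L' κ') (hz : z ∈ Ω) (a c : E) :
    dhForm G (fun w a => fderiv ℝ P w (0, a)) z a c = 0 := by
  revert a c
  revert z
  rw [hamel_iff hΩ hG hP]
  intro z hz a
  have hI := (hκ.isoOn hL).proj hΩ hG hP h
  have h1 := hI.unique hE h0 (hκ'.isoOn hL') hz
  have h2 : fderiv ℝ (projRicci G P fun w => κ * L w) z (0, a) = κ' * fderiv ℝ L' z (0, a) := by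
    rw [fderiv_eq_of_eqOn hΩ (fun w hw => (hI.unique hE h0 (hκ'.isoOn hL') hw).1) hz,
      fderiv_const_mul (smooth_diff (hL'.smooth z hz)), smul_apply, smul_eq_mul]
  have h3 := h1.2 a
  rw [fderiv_projRicci (hG.smooth z hz) (hP.smooth z hz)
    (contDiffAt_const.mul (hL.smooth z hz)), fderiv_const_mul (smooth_diff (hL.smooth z hz)),
    smul_apply, smul_eq_mul] at h2
  simp only [projForm] at h3
  linarith

/-- If the projective factor is a Hamel function and `F` has constant flag curvature, then
the Jacobi endomorphism of `F'` is `k (F'² J - F' d_J F' ⊗ 𝒞)` for a function `k` which is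
constant on the fibres and whose differential satisfies `dk ∧ d_J F'² = 0`. -/
lemma ConstFlag.of_hamel (hE : NotLine E) (h0 : ∀ w ∈ Ω, w.2 ≠ 0) (hΩ : IsOpen Ω)
    (hG : EulerOn Ω 2 G) (hG' : EulerOn Ω 2 G') (hP : EulerOn Ω 1 P)
    (h : ∀ w ∈ Ω, G' w = G w + P w • w.2)
    (hL : EulerOn Ω 2 L) (hL' : EulerOn Ω 2 L') (hpos : ∀ w ∈ Ω, 0 < L' w)
    (hEL : EulerLagrange Ω G L) (hEL' : EulerLagrange Ω G' L') {κ : ℝ} (hκ : ConstFlag Ω G L κ)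
    (hH : ∀ z ∈ Ω, ∀ a c, dhForm G (fun w a => fderiv ℝ P w (0, a)) z a c = 0) :
    ∃ k : E × E → ℝ, (∀ z ∈ Ω, ContDiffAt ℝ ∞ k z) ∧ (∀ z ∈ Ω, ∀ a, fderiv ℝ k z (0, a) = 0) ∧
      (∀ z ∈ Ω, ∀ a c, fderiv ℝ k z (a, 0) * fderiv ℝ L' z (0, c) =
        fderiv ℝ k z (c, 0) * fderiv ℝ L' z (0, a)) ∧
      ∀ z ∈ Ω, ∀ a, SprayGeometry.jac G' z a =
        (k z * L' z) • a - (k z / 2 * fderiv ℝ L' z (0, a)) • z.2 := by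
  rw [hamel_iff hΩ hG hP] at hH
  have hIκ := hκ.isoOn hL
  have hI := hIκ.proj hΩ hG hP h
  set ρ : E × E → ℝ := projRicci G P fun w => κ * L w with hρ
  have hρs := hI.smooth_ricci
  -- the form `α'` of the changed spray is half of `d_J ρ'`
  have hα : ∀ z ∈ Ω, ∀ a, κ / 2 * fderiv ℝ L z (0, a) + projForm G P z a =
      1 / 2 * fderiv ℝ ρ z (0, a) := by
    intro z hz a
    rw [hρ, fderiv_projRicci (hG.smooth z hz) (hP.smooth z hz)
      (contDiffAt_const.mul (hL.smooth z hz)), fderiv_const_mul (smooth_diff (hL.smooth z hz)),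
      smul_apply, smul_eq_mul, projForm, hH z hz a]
    ring
  have hjac : ∀ z ∈ Ω, ∀ a, SprayGeometry.jac G' z a =
      ρ z • a - (1 / 2 * fderiv ℝ ρ z (0, a)) • z.2 := by
    intro z hz a
    rw [← hα z hz a]
    exact hI.jac z hz a
  have hρL : ∀ z ∈ Ω, ∀ a, ρ z * fderiv ℝ L' z (0, a) = fderiv ℝ ρ z (0, a) * L' z := by
    intro z hz a
    have h1 := hEL'.jac hΩ hG' hL' hz a
    rw [hjac z hz, vert_sub, vert_smul, vert_smul, map_sub, map_smul, map_smul,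
      hL'.euler z hz] at h1
    simp only [smul_eq_mul] at h1
    linarith
  have hks : ∀ z ∈ Ω, ContDiffAt ℝ ∞ (fun w => ρ w / L' w) z := fun z hz =>
    (hρs z hz).div (hL'.smooth z hz) (hpos z hz).ne'
  have hk : ∀ z ∈ Ω, ρ z = (ρ z / L' z) * L' z := fun z hz =>
    (div_mul_cancel₀ _ (hpos z hz).ne').symm
  have hkd : ∀ z ∈ Ω, ∀ u, fderiv ℝ ρ z u =
      fderiv ℝ (fun w => ρ w / L' w) z u * L' z + (ρ z / L' z) * fderiv ℝ L' z u := by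
    intro z hz u
    rw [fderiv_eq_of_eqOn hΩ hk hz, fderiv_fun_mul (smooth_diff (hks z hz))
      (smooth_diff (hL'.smooth z hz))]
    simp
    ring
  have hkv : ∀ z ∈ Ω, ∀ a, fderiv ℝ (fun w => ρ w / L' w) z (0, a) = 0 := by
    intro z hz a
    have h1 := hρL z hz a
    have h2 := hkd z hz (0, a)
    have h3 := hk z hz
    have h4 := hpos z hz
    have h5 : fderiv ℝ (fun w => ρ w / L' w) z (0, a) * (L' z * L' z) = 0 := by
      rw [h2] at h1
      generalize ρ z / L' z = k at h1 h3
      rw [h3] at h1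
      linarith
    rcases mul_eq_zero.1 h5 with h | h
    · exact h
    · exact absurd h (by positivity)
  have hρv : ∀ z ∈ Ω, ∀ a, fderiv ℝ ρ z (0, a) = (ρ z / L' z) * fderiv ℝ L' z (0, a) := by
    intro z hz a
    rw [hkd z hz, hkv z hz, zero_mul, zero_add]
  refine ⟨fun w => ρ w / L' w, hks, hkv, ?_, ?_⟩
  · intro z hz a c
    -- the projective invariance of `d_h ξ`, where `ξ = κ/2 d_J L` and `ξ' = 1/2 d_J ρ`
    have hξ : ∀ w ∈ Ω, ∀ a, curvForm (fun w => κ * L w) (fun w a => κ / 2 * fderiv ℝ L w (0, a)) w a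
        = κ / 2 * fderiv ℝ L w (0, a) := by
      intro w hw a
      rw [curvForm, fderiv_const_mul (smooth_diff (hL.smooth w hw)), smul_apply, smul_eq_mul]
      ring
    have hξ' : ∀ w ∈ Ω, ∀ c, 1 / 2 * fderiv ℝ ρ w (0, c) =
        curvForm (fun w => κ * L w) (fun w a => κ / 2 * fderiv ℝ L w (0, a)) w c
        + (P w * fderiv ℝ P w (0, c) - fderiv ℝ P w (horiz G c w)) := by
      intro w hw c
      rw [hξ w hw, ← hα w hw, projForm, hH w hw]
      ring
    have h1 := dhForm_proj hΩ hG hP h (fun c => hIκ.curvForm_euler hE h0 hΩ hG c)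
      (ξ' := fun w c => 1 / 2 * fderiv ℝ ρ w (0, c)) hξ' (fun w hw a c => hIκ.curv hΩ hG hw a c)
      hz a c
    have h2 : ∀ a u, fderiv ℝ (fun w => curvForm (fun w => κ * L w)
        (fun w a => κ / 2 * fderiv ℝ L w (0, a)) w a) z u =
        κ / 2 * fderiv ℝ (fderiv ℝ L) z u (0, a) := by
      intro a u
      have hLz := hL.smooth z hz
      rw [fderiv_eq_of_eqOn hΩ (fun w hw => hξ w hw a) hz, fderiv_const_mul
        (smooth_diff ((smooth_fderiv hLz).clm_apply contDiffAt_const)), smul_apply,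
        fderiv_fderiv_const hLz, smul_eq_mul]
    have h3 : ∀ a u, fderiv ℝ (fun w => 1 / 2 * fderiv ℝ ρ w (0, a)) z u =
        1 / 2 * (fderiv ℝ (fun w => ρ w / L' w) z u * fderiv ℝ L' z (0, a)
          + (ρ z / L' z) * fderiv ℝ (fderiv ℝ L') z u (0, a)) := by
      intro a u
      have hLz := hL'.smooth z hz
      have hd : DifferentiableAt ℝ (fun w => fderiv ℝ L' w (0, a)) z :=
        smooth_diff ((smooth_fderiv hLz).clm_apply contDiffAt_const)
      rw [fderiv_const_mul (smooth_diff ((smooth_fderiv (hρs z hz)).clm_apply contDiffAt_const)),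
        fderiv_eq_of_eqOn hΩ (fun w hw => hρv w hw a) hz, smul_apply,
        fderiv_fun_mul (smooth_diff (hks z hz)) hd, add_apply, smul_apply, smul_apply,
        fderiv_fderiv_const hLz]
      simp only [smul_eq_mul]
      ring
    have h4 : ∀ a, fderiv ℝ (fun w => ρ w / L' w) z (horiz G' a z) =
        fderiv ℝ (fun w => ρ w / L' w) z (a, 0) := by
      intro a
      rw [horiz_eq, map_sub, hkv z hz, sub_zero]
    simp only [dhForm, h2, h3, h4] at h1
    rw [hEL.dhForm hΩ hG hL hz a c, hEL'.dhForm hΩ hG' hL' hz a c] at h1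
    linarith
  · intro z hz a
    rw [hjac z hz a, hρv z hz a]
    change _ = (ρ z / L' z * L' z) • a - _
    rw [← hk z hz]
    congr 2
    ring

/-- A function `k` on `W × (E ∖ 0)` which is constant on the fibres and satisfies
`dk ∧ d_J L = 0` for a positive `2`-homogeneous function `L` is locally constant. -/
lemma locally_const_of_wedge (hE : 1 < Module.rank ℝ E) {W : Set E} (hW : IsOpen W)
    (hΩW : Ω = {z | z.1 ∈ W ∧ z.2 ≠ 0}) (hL : EulerOn Ω 2 L) (hpos : ∀ w ∈ Ω, 0 < L w)
    {k : E × E → ℝ} (hk : ∀ z ∈ Ω, ContDiffAt ℝ ∞ k z)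
    (hv : ∀ z ∈ Ω, ∀ a, fderiv ℝ k z (0, a) = 0)
    (hw : ∀ z ∈ Ω, ∀ a c, fderiv ℝ k z (a, 0) * fderiv ℝ L z (0, c) =
        fderiv ℝ k z (c, 0) * fderiv ℝ L z (0, a)) (hz : z ∈ Ω) :
    ∀ᶠ x in 𝓝 z.1, ∀ y ≠ 0, k (x, y) = k z := by
  have mem : ∀ x ∈ W, ∀ y ≠ 0, (x, y) ∈ Ω := fun x hx y hy => by rw [hΩW]; exact ⟨hx, hy⟩
  have hzW : z.1 ∈ W := by rw [hΩW] at hz; exact hz.1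
  have hz0 : z.2 ≠ 0 := by rw [hΩW] at hz; exact hz.2
  -- `k` is constant on the fibres, which are connected
  have fib : ∀ x ∈ W, ∀ y ≠ 0, ∀ y' ≠ 0, k (x, y) = k (x, y') := by
    intro x hx y hy y' hy'
    have hd : ∀ y ≠ 0, HasFDerivAt (fun y => k (x, y))
        ((fderiv ℝ k (x, y)).comp (ContinuousLinearMap.inr ℝ E E)) y := fun y hy =>
      (smooth_diff (hk _ (mem x hx y hy))).hasFDerivAt.comp y (hasFDerivAt_prodMk_right x y)
    refine IsOpen.is_const_of_fderiv_eq_zero (𝕜 := ℝ) (f := fun y => k (x, y)) (s := {0}ᶜ)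
      isOpen_compl_singleton
      (isConnected_compl_singleton_of_one_lt_rank hE (0 : E)).isPreconnected
      (fun y hy => (hd y hy).differentiableAt.differentiableWithinAt) (fun y hy => ?_) hy hy'
    rw [(hd y hy).fderiv]
    ext a
    exact hv _ (mem x hx y hy) a
  have hbase : ∀ x ∈ W, ∀ y ≠ 0, HasFDerivAt (fun x => k (x, y))
      ((fderiv ℝ k (x, y)).comp (ContinuousLinearMap.inl ℝ E E)) x := fun x hx y hy =>
    (smooth_diff (hk _ (mem x hx y hy))).hasFDerivAt.comp x (hasFDerivAt_prodMk_left x y)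
  -- hence the horizontal differential does not depend on the point of the fibre
  have hind : ∀ x ∈ W, ∀ y ≠ 0, ∀ y' ≠ 0, ∀ a,
      fderiv ℝ k (x, y) (a, 0) = fderiv ℝ k (x, y') (a, 0) := by
    intro x hx y hy y' hy' a
    have h1 : (fun x => k (x, y)) =ᶠ[𝓝 x] fun x => k (x, y') := by
      filter_upwards [hW.mem_nhds hx] with x' hx'
      exact fib x' hx' y hy y' hy'
    have h2 := h1.fderiv_eq (𝕜 := ℝ)
    rw [(hbase x hx y hy).fderiv, (hbase x hx y' hy').fderiv] at h2
    exact DFunLike.congr_fun h2 a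
  -- at a nonzero vector in the kernel of this differential, the hypothesis makes it vanish
  have hzero : ∀ x ∈ W, ∀ y ≠ 0, ∀ a, fderiv ℝ k (x, y) (a, 0) = 0 := by
    intro x hx y hy a
    obtain ⟨y', hy', hker⟩ : ∃ y' : E, y' ≠ 0 ∧ fderiv ℝ k (x, y) (y', 0) = 0 := by
      by_contra hcon
      push Not at hcon
      have hinj : Function.Injective
          (((fderiv ℝ k (x, y)).comp (ContinuousLinearMap.inl ℝ E E) : E →L[ℝ] ℝ) : E →ₗ[ℝ] ℝ) := by
        rw [injective_iff_map_eq_zero]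
        intro b hb
        by_contra hb0
        exact hcon b hb0 hb
      have := LinearMap.lift_rank_le_of_injective _ hinj
      simp only [Module.rank_self, Cardinal.lift_one, Cardinal.lift_uzero] at this
      exact absurd hE this.not_gt
    have hm := mem x hx y' hy'
    have h1 := hw _ hm y' a
    rw [hind x hx y' hy' y hy y', hker, zero_mul, hL.euler _ hm] at h1
    rw [hind x hx y hy y' hy' a]
    refine (mul_eq_zero.1 h1.symm).resolve_right ?_
    have := hpos _ hm
    simp only [smul_eq_mul]
    positivity
  obtain ⟨r, hr, hball⟩ := Metric.isOpen_iff.1 hW z.1 hzW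
  filter_upwards [Metric.ball_mem_nhds z.1 hr] with x hx y hy
  rw [fib x (hball hx) y hy z.2 hz0]
  refine IsOpen.is_const_of_fderiv_eq_zero (𝕜 := ℝ) (f := fun x => k (x, z.2))
    Metric.isOpen_ball (convex_ball z.1 r).isPreconnected
    (fun x hx => (hbase x (hball hx) z.2 hz0).differentiableAt.differentiableWithinAt)
    (fun x hx => ?_) hx (Metric.mem_ball_self hr)
  rw [(hbase x (hball hx) z.2 hz0).fderiv]
  ext a
  exact hzero x (hball hx) z.2 hz0 a

lemma notLine_of_rank (hE : 1 < Module.rank ℝ E) : NotLine E := by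
  intro y
  by_contra h
  push Not at h
  refine hE.not_ge ?_
  have hs : Function.Surjective (LinearMap.toSpanSingleton ℝ E y) := fun c => by
    obtain ⟨s, hs⟩ := h c
    exact ⟨s, hs.symm⟩
  have := LinearMap.lift_rank_le_of_surjective _ hs
  simpa using this

end ConstantFlagCurvature

end

section

variable {n : ℕ} {M : Type*} [TopologicalSpace M] [ChartedSpace (EuclideanSpace ℝ (Fin n)) M]
  [IsManifold (𝓡 n) ∞ M]

/-! ### The Frölicher–Nijenhuis calculus of a spray in a chart -/

/-- The coefficients `G` of the spray `S` in the chart at `q`. -/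
def coeff (q : TangentBundle (𝓡 n) M) (S : VField (n := n) M) (z : Model n × Model n) : Model n :=
  -((1 / 2 : ℝ) • (loc q S z).2)

/-- The components of a semi-basic form in the chart at `q`. -/
def locForm (q : TangentBundle (𝓡 n) M) (η : OneForm (n := n) M) (z : Model n × Model n) :
    Model n →L[ℝ] ℝ :=
  (η (param q z)).comp ((paramD q z).comp (ContinuousLinearMap.inl ℝ (Model n) (Model n)))

section Local

variable {q : TangentBundle (𝓡 n) M} {z : Model n × Model n} {S X Y : VField (n := n) M}

lemma eventually_coord (hz : z ∈ coordDomain q) : ∀ᶠ w in 𝓝 z, w ∈ coordDomain q :=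
  (isOpen_coordDomain q).mem_nhds hz

lemma eventually_slit (hz : z ∈ slitDomain q) : ∀ᶠ w in 𝓝 z, w ∈ slitDomain q :=
  (isOpen_slitDomain q).mem_nhds hz

lemma SmoothNear.param_eventually (hz : z ∈ coordDomain q) (h : SmoothNear X (param q z)) :
    ∀ᶠ w in 𝓝 z, SmoothNear X (param q w) :=
  eventually_param hz h.eventually

/-- Vector fields with smooth components are smooth. -/
lemma smoothNear_of_eventuallyEq (hz : z ∈ coordDomain q)
    {U : Model n × Model n → Model n × Model n}
    (h : ∀ᶠ w in 𝓝 z, loc q X w = U w) (hU : ∀ᶠ w in 𝓝 z, ContDiffAt ℝ ∞ U w) :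
    SmoothNear X (param q z) := by
  refine smoothNear_of_loc hz ?_
  filter_upwards [h.eventually_nhds, hU] with w hw hw'
  exact hw'.congr_of_eventuallyEq hw

lemma smoothNear_liouville (hz : z ∈ coordDomain q) :
    SmoothNear (liouville : VField (n := n) M) (param q z) :=
  smoothNear_of_eventuallyEq hz ((eventually_coord hz).mono fun _ hw => loc_liouville hw)
    (Filter.Eventually.of_forall fun _ => contDiffAt_const.prodMk contDiffAt_snd)

lemma SmoothNear.opJ (hz : z ∈ coordDomain q) (h : SmoothNear X (param q z)) :
    SmoothNear (opJ X) (param q z) := by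
  refine smoothNear_of_eventuallyEq hz ((eventually_coord hz).mono fun w hw => loc_opJ hw X) ?_
  filter_upwards [h.param_eventually hz, eventually_coord hz] with w hw hw'
  exact contDiffAt_const.prodMk (hw.contDiffAt_loc hw').fst

lemma IsSpray.smoothNear (hS : IsSpray S) (hz : z ∈ slitDomain q) : SmoothNear S (param q z) :=
  hS.smooth _ (param_mem_slit hz)

lemma IsSpray.loc_eq (hS : IsSpray S) (hz : z ∈ slitDomain q) :
    loc q S z = sprayVec (coeff q S) z := by
  have h1 : loc q (SprayGeometry.opJ S) z = loc q liouville z :=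
    loc_congr (hS.vertEnd_apply _ (param_mem_slit hz))
  rw [loc_opJ hz.1, loc_liouville hz.1] at h1
  refine Prod.ext (congrArg Prod.snd h1) ?_
  simp [sprayVec, coeff]

lemma IsSpray.coeff_euler (hS : IsSpray S) : EulerOn (slitDomain q) 2 (coeff q S) where
  smooth z hz := ((((hS.smoothNear hz).contDiffAt_loc hz.1).snd).const_smul (1 / 2 : ℝ)).neg
  euler z hz := by
    have hs := (hS.smoothNear hz).contDiffAt_loc hz.1
    have h1 : loc q (bracket liouville S) z = loc q S z :=
      loc_congr (hS.homogeneous _ (param_mem_slit hz))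
    have h2 : loc q liouville =ᶠ[𝓝 z] fun w => ((0 : Model n), w.2) :=
      (eventually_coord hz.1).mono fun w hw => loc_liouville hw
    rw [loc_bracket hz.1 (smoothNear_liouville hz.1) (hS.smoothNear hz), h2.fderiv_eq,
      h2.self_of_nhds, (hasFDerivAt_vert z).fderiv] at h1
    have h3 : (fderiv ℝ (loc q S) z (0, z.2)).2 = (2 : ℝ) • (loc q S z).2 := by
      have := congrArg Prod.snd h1
      simp only [Prod.snd_sub, ContinuousLinearMap.comp_apply, ContinuousLinearMap.coe_snd',
        ContinuousLinearMap.inr_apply] at this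
      rw [two_smul, ← sub_eq_iff_eq_add]
      exact this
    have h4 := (((smooth_diff hs).hasFDerivAt.snd).const_smul (1 / 2 : ℝ)).neg
    have h5 : fderiv ℝ (coeff q S) z = _ := h4.fderiv
    rw [h5]
    simp only [neg_apply, smul_apply, ContinuousLinearMap.comp_apply,
      ContinuousLinearMap.coe_snd', h3, coeff]
    module

lemma IsSpray.contDiffAt_coeff (hS : IsSpray S) (hz : z ∈ slitDomain q) :
    ContDiffAt ℝ ∞ (coeff q S) z := hS.coeff_euler.smooth z hz

lemma IsSpray.fderiv_loc (hS : IsSpray S) (hz : z ∈ slitDomain q) (u : Model n × Model n) :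
    fderiv ℝ (loc q S) z u = (u.2, 0) - (2 : ℝ) • (0, fderiv ℝ (coeff q S) z u) := by
  rw [fderiv_eq_of_eqOn (isOpen_slitDomain q) (fun w hw => hS.loc_eq hw) hz,
    fderiv_sprayVec (hS.contDiffAt_coeff hz)]

/-- The bracket with a spray, in components. -/
lemma IsSpray.loc_bracket (hS : IsSpray S) (hz : z ∈ slitDomain q) (hX : SmoothNear X (param q z)) :
    loc q (bracket S X) z = fderiv ℝ (loc q X) z (sprayVec (coeff q S) z)
      - (((loc q X z).2, 0) - (2 : ℝ) • (0, fderiv ℝ (coeff q S) z (loc q X z))) := by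
  rw [SprayGeometry.loc_bracket hz.1 (hS.smoothNear hz) hX, hS.loc_eq hz, hS.fderiv_loc hz]

lemma IsSpray.loc_fnBracket_opJ (hS : IsSpray S) (hz : z ∈ slitDomain q)
    (hX : SmoothNear X (param q z)) :
    loc q (fnBracket S opJ X) z =
      (-(loc q X z).1, (loc q X z).2 + (2 : ℝ) • conn (coeff q S) z (loc q X z).1) := by
  have h1 : loc q (opJ X) =ᶠ[𝓝 z] fun w => ((0 : Model n), (loc q X w).1) :=
    (eventually_coord hz.1).mono fun w hw => loc_opJ hw X
  have h2 : fderiv ℝ (fun w => ((0 : Model n), (loc q X w).1)) z (sprayVec (coeff q S) z) =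
      (0, (fderiv ℝ (loc q X) z (sprayVec (coeff q S) z)).1) := by
    have h3 := (hasFDerivAt_const (0 : Model n) z).prodMk
      (smooth_diff (hX.contDiffAt_loc hz.1)).hasFDerivAt.fst
    rw [h3.fderiv]
    rfl
  rw [fnBracket, loc_sub hz.1, hS.loc_bracket hz (hX.opJ hz.1), loc_opJ hz.1,
    loc_opJ hz.1, hS.loc_bracket hz hX, h1.fderiv_eq, h2, conn_apply]
  ext1
  · simp
  · simp only [Prod.snd_sub, Prod.smul_snd]
    simp
    abel

lemma IsSpray.loc_opH (hS : IsSpray S) (hz : z ∈ slitDomain q) (hX : SmoothNear X (param q z)) :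
    loc q (opH S X) z = horiz (coeff q S) (loc q X z).1 z := by
  rw [opH, loc_smul hz.1, loc_sub hz.1, hS.loc_fnBracket_opJ hz hX]
  ext1
  · simp only [horiz, Prod.smul_fst, Prod.fst_sub]
    module
  · simp only [horiz, Prod.smul_snd, Prod.snd_sub]
    module

lemma IsSpray.loc_opV (hS : IsSpray S) (hz : z ∈ slitDomain q) (hX : SmoothNear X (param q z)) :
    loc q (opV S X) z = (0, (loc q X z).2 + conn (coeff q S) z (loc q X z).1) := by
  rw [opV, loc_smul hz.1, loc_add hz.1, hS.loc_fnBracket_opJ hz hX]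
  ext1
  · simp only [Prod.smul_fst, Prod.fst_add]
    module
  · simp only [Prod.smul_snd, Prod.snd_add]
    module

lemma IsSpray.eventually_loc_opH (hS : IsSpray S) (hz : z ∈ slitDomain q)
    (hX : SmoothNear X (param q z)) :
    loc q (opH S X) =ᶠ[𝓝 z] fun w => ((loc q X w).1, -conn (coeff q S) w (loc q X w).1) := by
  filter_upwards [eventually_slit hz, hX.param_eventually hz.1] with w hw hw'
  exact hS.loc_opH hw hw'

lemma IsSpray.smoothNear_opH (hS : IsSpray S) (hz : z ∈ slitDomain q)
    (hX : SmoothNear X (param q z)) : SmoothNear (opH S X) (param q z) := by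
  refine smoothNear_of_eventuallyEq hz.1 (hS.eventually_loc_opH hz hX) ?_
  filter_upwards [eventually_slit hz, hX.param_eventually hz.1] with w hw hw'
  exact ((hw'.contDiffAt_loc hw.1).fst).prodMk
    ((contDiffAt_conn (hS.contDiffAt_coeff hw)).clm_apply (hw'.contDiffAt_loc hw.1).fst).neg

lemma IsSpray.fderiv_loc_opH (hS : IsSpray S) (hz : z ∈ slitDomain q)
    (hX : SmoothNear X (param q z)) (u : Model n × Model n) :
    fderiv ℝ (loc q (opH S X)) z u = ((fderiv ℝ (loc q X) z u).1,
      -(fderiv ℝ (fderiv ℝ (coeff q S)) z u (0, (loc q X z).1)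
        + conn (coeff q S) z (fderiv ℝ (loc q X) z u).1)) := by
  have hG := hS.contDiffAt_coeff hz
  have hU := smooth_diff (hX.contDiffAt_loc hz.1)
  have hc := smooth_diff (contDiffAt_conn hG)
  have h1 := hU.hasFDerivAt.fst.prodMk (hc.hasFDerivAt.clm_apply hU.hasFDerivAt.fst).neg
  have h3 : fderiv ℝ (fun w => ((loc q X w).1, -conn (coeff q S) w (loc q X w).1)) z = _ :=
    h1.fderiv
  rw [(hS.eventually_loc_opH hz hX).fderiv_eq, h3]
  have h2 : ∀ a, fderiv ℝ (conn (coeff q S)) z u a =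
      fderiv ℝ (fderiv ℝ (coeff q S)) z u (0, a) := by
    intro a
    rw [← fderiv_fderiv_const hG]
    have := fderiv_clm_apply_apply hc (differentiableAt_const a) u
    simp only [fderiv_fun_const, Pi.zero_apply, zero_apply, map_zero, add_zero] at this
    exact this.symm
  ext1
  · simp
  · simp [h2, add_comm]

/-- The Jacobi endomorphism of a spray, in components. -/
lemma IsSpray.loc_jacobiEnd (hS : IsSpray S) (hz : z ∈ slitDomain q)
    (hX : SmoothNear X (param q z)) :
    loc q (jacobiEnd S X) z = (0, jac (coeff q S) z (loc q X z).1) := by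
  have hH := hS.smoothNear_opH hz hX
  have hB := (hS.smoothNear hz).bracket hX
  have hBH := (hS.smoothNear hz).bracket hH
  have hHB := hS.smoothNear_opH hz hB
  have hY : SmoothNear (fnBracket S (opH S) X) (param q z) := by
    refine smoothNear_of_eventuallyEq hz.1
      ((eventually_coord hz.1).mono fun w hw => loc_sub hw _ _) ?_
    filter_upwards [eventually_coord hz.1, hBH.param_eventually hz.1,
      hHB.param_eventually hz.1] with w hw h1 h2
    exact (h1.contDiffAt_loc hw).sub (h2.contDiffAt_loc hw)
  rw [jacobiEnd, hS.loc_opV hz hY, fnBracket, loc_sub hz.1, hS.loc_bracket hz hH,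
    hS.fderiv_loc_opH hz hX, hS.loc_opH hz hB, hS.loc_opH hz hX, hS.loc_bracket hz hX, jac]
  refine Prod.ext rfl ?_
  simp only [horiz, Prod.fst_sub, Prod.snd_sub, Prod.smul_snd, Prod.smul_fst, smul_zero, sub_zero,
    map_sub, map_neg, conn_apply, zero_sub]
  have h1 : ((loc q X z).1, -fderiv ℝ (coeff q S) z (0, (loc q X z).1)) =
    ((loc q X z).1, 0) - (0, fderiv ℝ (coeff q S) z (0, (loc q X z).1)) := by simp
  rw [h1]
  simp only [map_sub]
  module

/-! ### Functions and forms in a chart -/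

lemma contDiffAt_param_of_smooth {f : TangentBundle (𝓡 n) M → ℝ} (hf : IsSmoothFun f)
    (hz : z ∈ slitDomain q) : ContDiffAt ℝ ∞ (fun w => f (param q w)) z := by
  refine (contMDiffAt_iff_param hz.1).1 (hf.contMDiffAt ?_)
  exact eventually_of_param hz.1 ((eventually_slit hz).mono fun w hw => param_mem_slit hw)

lemma isSmoothFun_of_param {f : TangentBundle (𝓡 n) M → ℝ}
    (h : ∀ q : TangentBundle (𝓡 n) M, ∀ z ∈ slitDomain q,
      ContDiffAt ℝ ∞ (fun w => f (param q w)) z) : IsSmoothFun f := by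
  intro v hv
  obtain ⟨q, z, hz, rfl⟩ := exists_chart hv
  exact ((contMDiffAt_iff_param hz.1).2 (h _ z hz)).contMDiffWithinAt

lemma param_smul (q : TangentBundle (𝓡 n) M) (z : Model n × Model n) (t : ℝ) :
    param q (z.1, t • z.2) = ⟨(param q z).1, t • (param q z).2⟩ := by
  rw [param_mk, map_smul]
  rfl

lemma PosHomogeneous.eulerOn {f : TangentBundle (𝓡 n) M → ℝ} (h : PosHomogeneous f)
    (hf : IsSmoothFun f) : EulerOn (slitDomain q) 1 (fun w => f (param q w)) where
  smooth z hz := contDiffAt_param_of_smooth hf hz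
  euler z hz := by
    have h1 : HasDerivAt (fun t : ℝ => (z.1, t • z.2)) (0, z.2) 1 := by
      simpa using (hasDerivAt_const (1 : ℝ) z.1).prodMk ((hasDerivAt_id (1 : ℝ)).smul_const z.2)
    have h0 : (z.1, (1 : ℝ) • z.2) = z := by simp
    have h2 : HasFDerivAt (fun w => f (param q w)) (fderiv ℝ (fun w => f (param q w)) z)
        (z.1, (1 : ℝ) • z.2) := by
      rw [h0]
      exact (smooth_diff (contDiffAt_param_of_smooth hf hz)).hasFDerivAt
    have h3 := h2.comp_hasDerivAt (1 : ℝ) h1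
    have h4 : HasDerivAt (fun t : ℝ => t * f (param q z)) (f (param q z)) 1 := by
      simpa using (hasDerivAt_id (1 : ℝ)).mul_const (f (param q z))
    have h5 : (fun w => f (param q w)) ∘ (fun t : ℝ => (z.1, t • z.2))
        =ᶠ[𝓝 1] fun t : ℝ => t * f (param q z) := by
      filter_upwards [lt_mem_nhds (zero_lt_one (α := ℝ))] with t ht
      simp only [Function.comp, param_smul]
      exact h _ (param_mem_slit hz) t ht
    rw [one_smul]
    exact h3.unique (h4.congr_of_eventuallyEq h5)

lemma dJ_param {f : TangentBundle (𝓡 n) M → ℝ} (hz : z ∈ coordDomain q)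
    (hf : DifferentiableAt ℝ (fun w => f (param q w)) z) (X : VField (n := n) M) :
    dJ f (param q z) (X (param q z)) =
      fderiv ℝ (fun w => f (param q w)) z (0, (loc q X z).1) := by
  rw [← loc_opJ hz, ← deriveAlong_param hz hf]
  rfl

lemma isSemibasic_dJ (f : TangentBundle (𝓡 n) M → ℝ) : IsSemibasic (dJ f) := by
  intro v _ w hw
  rw [dJ, ContinuousLinearMap.comp_apply, vertEnd, ContinuousLinearMap.comp_apply, hw, map_zero,
    map_zero]

lemma IsSemibasic.apply_param {η : OneForm (n := n) M} (hη : IsSemibasic η)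
    (hz : z ∈ slitDomain q) (X : VField (n := n) M) :
    η (param q z) (X (param q z)) = locForm q η z (loc q X z).1 := by
  have h1 : loc q X z = ((loc q X z).1, 0) + (0, (loc q X z).2) := by simp
  rw [← paramD_loc hz.1 X, h1, map_add, map_add, hη _ (param_mem_slit hz) (paramD q z (0, _)),
    add_zero]
  · simp [locForm]
  · rw [dproj_paramD hz.1]
    simp

lemma locForm_dJ {f : TangentBundle (𝓡 n) M → ℝ} (hf : IsSmoothFun f) (hz : z ∈ slitDomain q)
    (a : Model n) : locForm q (dJ f) z a = fderiv ℝ (fun w => f (param q w)) z (0, a) := by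
  have h1 := (isSemibasic_dJ f).apply_param hz (constField q (a, 0))
  rw [dJ_param hz.1 (smooth_diff (contDiffAt_param_of_smooth hf hz)), loc_constField hz.1] at h1
  exact h1.symm

lemma IsSmoothForm.contDiffAt_locForm {η : OneForm (n := n) M} (hη : IsSmoothForm η)
    (hs : IsSemibasic η) (hz : z ∈ slitDomain q) (a : Model n) :
    ContDiffAt ℝ ∞ (fun w => locForm q η w a) z := by
  have h1 := (contMDiffAt_iff_param hz.1).1 (hη _ (param_mem_slit hz) (constField q (a, 0))
    (smoothNear_constField hz.1 _))
  refine h1.congr_of_eventuallyEq ?_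
  filter_upwards [eventually_slit hz] with w hw
  rw [hs.apply_param hw, loc_constField hw.1]

/-- The derivative of the evaluation of a semi-basic form on a vector field. -/
lemma IsSemibasic.deriveAlong {η : OneForm (n := n) M} (hη : IsSemibasic η)
    (hz : z ∈ slitDomain q) (hd : DifferentiableAt ℝ (locForm q η) z)
    (hY : SmoothNear Y (param q z)) (X : VField (n := n) M) :
    deriveAlong X (fun w => η w (Y w)) (param q z) =
      fderiv ℝ (fun w => locForm q η w (loc q Y z).1) z (loc q X z)
        + locForm q η z (fderiv ℝ (loc q Y) z (loc q X z)).1 := by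
  have hV := smooth_diff (hY.contDiffAt_loc hz.1)
  have h1 : (fun w => η (param q w) (Y (param q w))) =ᶠ[𝓝 z]
      fun w => locForm q η w (loc q Y w).1 := by
    filter_upwards [eventually_slit hz] with w hw
    exact hη.apply_param hw Y
  have h2 : DifferentiableAt ℝ (fun w => locForm q η w (loc q Y w).1) z := hd.clm_apply hV.fst
  rw [deriveAlong_param hz.1 (h2.congr_of_eventuallyEq h1), h1.fderiv_eq,
    fderiv_clm_apply_apply hd hV.fst, fderiv_clm_apply_apply hd (differentiableAt_const _),
    hV.hasFDerivAt.fst.fderiv]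
  simp

/-- `d_h η` in components, for a semi-basic form `η`. -/
lemma IsSpray.dAlong_opH (hS : IsSpray S) {η : OneForm (n := n) M} (hη : IsSemibasic η)
    (hz : z ∈ slitDomain q) (hd : DifferentiableAt ℝ (locForm q η) z)
    (hX : SmoothNear X (param q z)) (hY : SmoothNear Y (param q z)) :
    dAlong (opH S) η X Y (param q z) =
      dhForm (coeff q S) (fun w a => locForm q η w a) z (loc q X z).1 (loc q Y z).1 := by
  have hHX := hS.smoothNear_opH hz hX
  have hHY := hS.smoothNear_opH hz hY
  have h1 := hη.apply_param hz (bracket (opH S X) Y + bracket X (opH S Y) - opH S (bracket X Y))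
  have h2 : (loc q (bracket (opH S X) Y + bracket X (opH S Y) - opH S (bracket X Y)) z).1 =
      (fderiv ℝ (loc q Y) z (loc q (opH S X) z)).1
        - (fderiv ℝ (loc q X) z (loc q (opH S Y) z)).1 := by
    rw [loc_sub hz.1, loc_add hz.1, hS.loc_opH hz (hX.bracket hY),
      SprayGeometry.loc_bracket hz.1 hHX hY, SprayGeometry.loc_bracket hz.1 hX hHY,
      SprayGeometry.loc_bracket hz.1 hX hY, hS.fderiv_loc_opH hz hX, hS.fderiv_loc_opH hz hY]
    simp only [horiz, Prod.fst_sub, Prod.fst_add]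
    abel
  rw [h2, map_sub] at h1
  rw [dAlong, hη.deriveAlong hz hd hY, hη.deriveAlong hz hd hX, dhForm]
  have h3 : bracket (opH S X) Y (param q z) + bracket X (opH S Y) (param q z)
      - opH S (bracket X Y) (param q z) =
    (bracket (opH S X) Y + bracket X (opH S Y) - opH S (bracket X Y)) (param q z) := rfl
  rw [h3, h1, hS.loc_opH hz hX, hS.loc_opH hz hY]
  ring

end Local

end

section

variable {n : ℕ} {M : Type*} [TopologicalSpace M] [ChartedSpace (EuclideanSpace ℝ (Fin n)) M]
  [IsManifold (𝓡 n) ∞ M]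

/-! ### Isotropic sprays on a manifold -/

section Isotropic

variable {q : TangentBundle (𝓡 n) M} {z : Model n × Model n} {S S' X Y : VField (n := n) M}
  {P ρ : TangentBundle (𝓡 n) M → ℝ} {α ξ : OneForm (n := n) M}

lemma one_lt_rank_model (hn : 1 < n) : 1 < Module.rank ℝ (Model n) := by
  rw [← Module.finrank_eq_rank, finrank_euclideanSpace_fin]
  exact_mod_cast hn

lemma exists_ne_zero_model (hn : 1 < n) : ∃ u : Model n, u ≠ 0 := by
  have : Nonempty (Fin n) := ⟨⟨0, by omega⟩⟩
  exact exists_ne 0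

lemma slitDomain_ne_zero : ∀ w ∈ slitDomain q, w.2 ≠ 0 := fun _ hw => hw.2

lemma dhForm_congr {E : Type*} [NormedAddCommGroup E] [NormedSpace ℝ E] {Ω : Set (E × E)}
    (hΩ : IsOpen Ω) {G : E × E → E} {η η' : E × E → E → ℝ} (h : ∀ w ∈ Ω, ∀ a, η w a = η' w a)
    {z : E × E} (hz : z ∈ Ω) (a c : E) : dhForm G η z a c = dhForm G η' z a c := by
  rw [dhForm, dhForm, fderiv_eq_of_eqOn hΩ (fun w hw => h w hw c) hz,
    fderiv_eq_of_eqOn hΩ (fun w hw => h w hw a) hz]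

/-- A form is differentiable if its values on constant vectors are smooth. -/
lemma differentiableAt_locForm {η : OneForm (n := n) M}
    (h : ∀ a, ∀ z ∈ slitDomain q, ContDiffAt ℝ ∞ (fun w => locForm q η w a) z)
    (hz : z ∈ slitDomain q) : DifferentiableAt ℝ (locForm q η) z := by
  have h1 : ContDiffOn ℝ ∞ (locForm q η) (slitDomain q) :=
    contDiffOn_clm_apply.2 fun a w hw => (h a w hw).contDiffWithinAt
  exact smooth_diff (h1.contDiffAt ((isOpen_slitDomain q).mem_nhds hz))

/-- The equation `Φ X = r J X - s 𝒞`, in components. -/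
lemma IsSpray.jacobiEnd_eq_iff (hS : IsSpray S) (hz : z ∈ slitDomain q)
    (hX : SmoothNear X (param q z)) (r s : ℝ) :
    jacobiEnd S X (param q z) = r • opJ X (param q z) - s • liouville (param q z) ↔
      jac (coeff q S) z (loc q X z).1 = r • (loc q X z).1 - s • z.2 := by
  rw [← paramD_loc hz.1 (jacobiEnd S X), ← paramD_loc hz.1 (opJ X), ← paramD_loc hz.1 liouville,
    hS.loc_jacobiEnd hz hX, loc_opJ hz.1, loc_liouville hz.1, ← map_smul, ← map_smul, ← map_sub,
    (paramD_injective hz.1).eq_iff, ← vert_smul, ← vert_smul, ← vert_sub, Prod.mk.injEq]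
  exact and_iff_right rfl

lemma IsSpray.jacobiEnd_constField_iff (hS : IsSpray S) (hz : z ∈ slitDomain q) (a : Model n)
    (r s : ℝ) :
    jacobiEnd S (constField q (a, 0)) (param q z) =
      r • opJ (constField q (a, 0)) (param q z) - s • liouville (param q z) ↔
      jac (coeff q S) z a = r • a - s • z.2 := by
  rw [hS.jacobiEnd_eq_iff hz (smoothNear_constField hz.1 _), loc_constField hz.1]

/-- `S' = S - 2 P 𝒞`, in terms of the spray coefficients. -/
lemma coeff_eq_add (h : ∀ v ∈ slit M, S' v = S v - (2 * P v) • liouville v) :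
    ∀ w ∈ slitDomain q, coeff q S' w = coeff q S w + P (param q w) • w.2 := by
  intro w hw
  have h1 : loc q S' w = loc q (S - (2 * P (param q w)) • liouville) w :=
    loc_congr (h _ (param_mem_slit hw))
  rw [loc_sub hw.1, loc_smul hw.1, loc_liouville hw.1] at h1
  rw [coeff, coeff, h1]
  simp only [Prod.snd_sub, Prod.smul_snd]
  module

lemma IsProjectiveFactor.coeff (h : IsProjectiveFactor S S' P) :
    ∀ w ∈ slitDomain q, coeff q S' w = coeff q S w + P (param q w) • w.2 :=
  coeff_eq_add h.eq

lemma IsProjectiveFactor.eulerOn (h : IsProjectiveFactor S S' P) :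
    EulerOn (slitDomain q) 1 (fun w => P (param q w)) := h.homogeneous.eulerOn h.smooth

lemma IsIsotropicWith.isoOn (h : IsIsotropicWith S ρ α) (hS : IsSpray S) :
    IsoOn (slitDomain q) (SprayGeometry.coeff q S) (fun w => ρ (param q w))
      (fun w a => locForm q α w a) where
  smooth_ricci z hz := contDiffAt_param_of_smooth h.smooth_ricci hz
  smooth_form a z hz := h.smooth_form.contDiffAt_locForm h.semibasic hz a
  jac z hz a := by
    have h1 := h.jacobi _ (param_mem_slit hz) (constField q (a, 0)) (smoothNear_constField hz.1 _)
    rw [h.semibasic.apply_param hz, loc_constField hz.1] at h1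
    exact (hS.jacobiEnd_constField_iff hz a _ _).1 h1

/-- A spray is isotropic if its Jacobi endomorphism is isotropic in every chart. The forms `β q` of
the charts glue because they are determined by the Jacobi endomorphism and `ρ`. -/
lemma IsSpray.exists_isIsotropicWith (hS : IsSpray S) (hρ : IsSmoothFun ρ)
    (β : TangentBundle (𝓡 n) M → Model n × Model n → Model n →L[ℝ] ℝ)
    (hβ : ∀ q, ∀ z ∈ slitDomain q, ∀ a, ContDiffAt ℝ ∞ (fun w => β q w a) z)
    (h : ∀ q, ∀ z ∈ slitDomain q, ∀ a,
      jac (SprayGeometry.coeff q S) z a = ρ (param q z) • a - β q z a • z.2) :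
    ∃ α, IsIsotropicWith S ρ α := by
  have key : ∀ v : TangentBundle (𝓡 n) M, ∃ A : TangentSpace (𝓡 n).tangent v →L[ℝ] ℝ,
      v ∈ slit M → (∀ w, dproj v w = 0 → A w = 0) ∧
        ∀ X : VField (n := n) M, SmoothNear X v →
          jacobiEnd S X v = ρ v • opJ X v - A (X v) • liouville v := by
    intro v
    by_cases hv : v ∈ slit M
    · obtain ⟨q, z, hz, rfl⟩ := exists_chart hv
      refine ⟨(β q z).comp ((ContinuousLinearMap.fst ℝ (Model n) (Model n)).comp
        (paramD q z).inverse), fun _ => ⟨fun w hw => ?_, fun X hX => ?_⟩⟩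
      · have h1 := (isInvertible_paramD hz.1).self_apply_inverse w
        rw [← h1, dproj_paramD hz.1, fibreMap_eq_zero hz.1] at hw
        simp only [ContinuousLinearMap.comp_apply, ContinuousLinearMap.coe_fst']
        rw [hw, map_zero]
      · exact (hS.jacobiEnd_eq_iff hz hX _ _).2 (h q z hz _)
    · exact ⟨0, fun h => absurd h hv⟩
  choose α hα using key
  have hsemi : IsSemibasic α := fun v hv => (hα v hv).1
  have hloc : ∀ q, ∀ z ∈ slitDomain q, ∀ a, locForm q α z a = β q z a := by
    intro q z hz a
    have h1 := (hα _ (param_mem_slit hz)).2 (constField q (a, 0)) (smoothNear_constField hz.1 _)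
    rw [hS.jacobiEnd_constField_iff hz, h q z hz, sub_right_inj, hsemi.apply_param hz,
      loc_constField hz.1] at h1
    exact (smul_left_injective ℝ hz.2 h1).symm
  refine ⟨α, hρ, fun v hv X hX => ?_, hsemi, fun v hv => (hα v hv).2⟩
  obtain ⟨q, z, hz, rfl⟩ := exists_chart hv
  rw [contMDiffAt_iff_param hz.1]
  have h1 : ContDiffOn ℝ ∞ (β q) (slitDomain q) :=
    contDiffOn_clm_apply.2 fun a w hw => (hβ q w hw a).contDiffWithinAt
  have h2 := (h1.contDiffAt ((isOpen_slitDomain q).mem_nhds hz)).clm_apply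
    (hX.contDiffAt_loc hz.1).fst
  refine h2.congr_of_eventuallyEq ?_
  filter_upwards [eventually_slit hz] with w hw
  rw [hsemi.apply_param hw, hloc q w hw]

/-- Projective changes preserve isotropy. -/
lemma IsIsotropicWith.proj (h : IsIsotropicWith S ρ α) (hS : IsSpray S) (hS' : IsSpray S')
    (hP : IsProjectiveFactor S S' P) : ∃ ρ' α', IsIsotropicWith S' ρ' α' := by
  have hρ' : ∀ q : TangentBundle (𝓡 n) M, ∀ z ∈ slitDomain q,
      ρ (param q z) + (P (param q z) ^ 2 - deriveAlong S P (param q z)) =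
      projRicci (SprayGeometry.coeff q S) (fun w => P (param q w)) (fun w => ρ (param q w)) z := by
    intro q z hz
    rw [projRicci, deriveAlong_param hz.1 (smooth_diff (hP.eulerOn.smooth z hz)), hS.loc_eq hz]
  have hI : ∀ q : TangentBundle (𝓡 n) M, _ := fun q => (h.isoOn (q := q) hS).proj
    (isOpen_slitDomain q) hS.coeff_euler hP.eulerOn hP.coeff
  refine ⟨fun v => ρ v + (P v ^ 2 - deriveAlong S P v), hS'.exists_isIsotropicWith
    (isSmoothFun_of_param fun q z hz => ?_)
    (fun q z => locForm q α z + LinearMap.toContinuousLinearMap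
      { toFun := projForm (SprayGeometry.coeff q S) (fun w => P (param q w)) z
        map_add' := fun a b => ?_
        map_smul' := fun r a => ?_ }) (fun q z hz a => (hI q).smooth_form a z hz)
    fun q z hz a => ?_⟩
  · refine ((hI q).smooth_ricci z hz).congr_of_eventuallyEq ?_
    filter_upwards [eventually_slit hz] with w hw
    exact hρ' q w hw
  · have h1 : (a + b, (0 : Model n)) = (a, 0) + (b, 0) := by simp
    simp only [projForm, horiz_eq, vert_add, map_add, map_sub, h1]
    ring
  · have h1 : (r • a, (0 : Model n)) = r • (a, 0) := by simp
    simp only [projForm, horiz_eq, vert_smul, map_smul, map_sub, h1, smul_eq_mul,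
      RingHom.id_apply]
    ring
  · rw [hρ' q z hz]
    exact (hI q).jac z hz a

lemma locForm_curvature (h : IsIsotropicWith S ρ α)
    (hξ : ∀ v ∈ slit M, ξ v = (1 / 3 : ℝ) • (α v + dJ ρ v)) (hz : z ∈ slitDomain q)
    (a : Model n) :
    locForm q ξ z a = curvForm (fun w => ρ (param q w)) (fun w a => locForm q α w a) z a := by
  rw [curvForm, ← locForm_dJ h.smooth_ricci hz, locForm, hξ _ (param_mem_slit hz)]
  simp only [ContinuousLinearMap.comp_apply, smul_apply, add_apply, smul_eq_mul, locForm]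

lemma isSemibasic_curvature (h : IsIsotropicWith S ρ α)
    (hξ : ∀ v ∈ slit M, ξ v = (1 / 3 : ℝ) • (α v + dJ ρ v)) : IsSemibasic ξ := by
  intro v hv w hw
  rw [hξ v hv, smul_apply, add_apply, h.semibasic v hv w hw, isSemibasic_dJ ρ v hv w hw, add_zero,
    smul_zero]

/-- `d_h ξ` is a projective invariant. -/
lemma dAlong_curvature (hn : 1 < n) (hS : IsSpray S) (hS' : IsSpray S')
    (hP : IsProjectiveFactor S S' P) {ξ' : OneForm (n := n) M} (hξ : IsCurvatureForm S ξ)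
    (hξ' : IsCurvatureForm S' ξ') {v : TangentBundle (𝓡 n) M} (hv : v ∈ slit M)
    (hX : SmoothNear X v) (hY : SmoothNear Y v) :
    dAlong (opH S') ξ' X Y v = dAlong (opH S) ξ X Y v := by
  obtain ⟨ρ, α, h, hξ⟩ := hξ
  obtain ⟨ρ', α', h', hξ'⟩ := hξ'
  obtain ⟨q, z, hz, rfl⟩ := exists_chart hv
  have hE := notLine_of_rank (one_lt_rank_model hn)
  have hΩ := isOpen_slitDomain q
  have hG : EulerOn (slitDomain q) 2 (SprayGeometry.coeff q S) := hS.coeff_euler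
  have hI := h.isoOn (q := q) hS
  have hI' := h'.isoOn (q := q) hS'
  have hIp := hI.proj hΩ hG hP.eulerOn hP.coeff
  have hl := fun w hw a => locForm_curvature (q := q) (z := w) h hξ hw a
  have hl' := fun w hw a => locForm_curvature (q := q) (z := w) h' hξ' hw a
  have hs : ∀ c, EulerOn (slitDomain q) 1
      (fun w => curvForm (fun w => ρ (param q w)) (fun w a => locForm q α w a) w c) :=
    fun c => hI.curvForm_euler hE slitDomain_ne_zero hΩ hG c
  have hs' : ∀ c, EulerOn (slitDomain q) 1
      (fun w => curvForm (fun w => ρ' (param q w)) (fun w a => locForm q α' w a) w c) :=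
    fun c => hI'.curvForm_euler hE slitDomain_ne_zero hΩ hS'.coeff_euler c
  have hd : DifferentiableAt ℝ (locForm q ξ) z := differentiableAt_locForm
    (fun a w hw => ((hs a).smooth w hw).congr_of_eventuallyEq
      (Filter.eventuallyEq_of_mem (hΩ.mem_nhds hw) fun u hu => hl u hu a)) hz
  have hd' : DifferentiableAt ℝ (locForm q ξ') z := differentiableAt_locForm
    (fun a w hw => ((hs' a).smooth w hw).congr_of_eventuallyEq
      (Filter.eventuallyEq_of_mem (hΩ.mem_nhds hw) fun u hu => hl' u hu a)) hz
  rw [hS'.dAlong_opH (isSemibasic_curvature h' hξ') hz hd' hX hY,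
    hS.dAlong_opH (isSemibasic_curvature h hξ) hz hd hX hY, dhForm_congr hΩ hl hz,
    dhForm_congr hΩ hl' hz]
  refine dhForm_proj hΩ hG hP.eulerOn hP.coeff hs (fun w hw c => ?_)
    (fun w hw a c => hI.curv hΩ hG hw a c) hz _ _
  -- by uniqueness, `ρ'` and `α'` are given by the transformation rule of projective changes
  rw [← curvForm_proj (hG.smooth w hw) (hP.eulerOn.smooth w hw) (hI.smooth_ricci w hw), curvForm,
    curvForm, (hI'.unique hE slitDomain_ne_zero hIp hw).2 c, fderiv_eq_of_eqOn hΩ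
      (fun u hu => (hI'.unique hE slitDomain_ne_zero hIp hu).1) hw]

end Isotropic

/-! ### Finsler metrics and Hamel functions in a chart -/

section Finsler

variable {q : TangentBundle (𝓡 n) M} {z : Model n × Model n} {S S' X Y : VField (n := n) M}
  {F P : TangentBundle (𝓡 n) M → ℝ}

lemma IsFinsler.smooth_energy (hF : IsFinsler F) : IsSmoothFun (fun v => F v ^ 2) :=
  hF.smooth.pow 2

lemma IsFinsler.eulerOn (hF : IsFinsler F) :
    EulerOn (slitDomain q) 2 (fun w => F (param q w) ^ 2) where
  smooth z hz := (contDiffAt_param_of_smooth hF.smooth hz).pow 2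
  euler z hz := by
    have h1 := (hF.homogeneous.eulerOn hF.smooth).euler z hz
    rw [fderiv_fun_pow _ (smooth_diff (contDiffAt_param_of_smooth hF.smooth hz)), smul_apply, h1]
    simp
    ring

lemma IsFinsler.energy_pos (hF : IsFinsler F) : ∀ w ∈ slitDomain q, 0 < F (param q w) ^ 2 :=
  fun _ hw => pow_pos (hF.pos _ (param_mem_slit hw)) 2

/-- The equation `i_S d d_J F² = - d F²`, tested on the coordinate fields of the base, is the system
of Euler-Lagrange equations. -/
lemma IsGeodesicSpray.eulerLagrange (hF : IsFinsler F) (hS : IsGeodesicSpray F S) :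
    EulerLagrange (slitDomain q) (coeff q S) (fun w => F (param q w) ^ 2) := by
  intro z hz a
  have hL := hF.eulerOn (q := q)
  have hX := smoothNear_constField hz.1 (a, (0 : Model n))
  have hsb := isSemibasic_dJ (fun v => F v ^ 2)
  have hd : DifferentiableAt ℝ (locForm q (dJ fun v => F v ^ 2)) z :=
    differentiableAt_locForm (fun a w hw => ((hL.vert (isOpen_slitDomain q) a).smooth w
      hw).congr_of_eventuallyEq ((eventually_slit hw).mono fun u hu =>
        locForm_dJ hF.smooth_energy hu a)) hz
  have hX0 : fderiv ℝ (loc q (constField q (a, (0 : Model n)))) z = 0 := by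
    rw [fderiv_eq_of_eqOn (isOpen_slitDomain q) (fun w hw => loc_constField hw.1 _) hz,
      fderiv_fun_const]
    rfl
  have h1 : deriveAlong S (fun w => dJ (fun v => F v ^ 2) w (constField q (a, (0 : Model n)) w))
      (param q z) = fderiv ℝ (fderiv ℝ fun w => F (param q w) ^ 2) z (sprayVec (coeff q S) z)
        (0, a) := by
    rw [hsb.deriveAlong hz hd hX, hX0, loc_constField hz.1, fderiv_eq_of_eqOn (isOpen_slitDomain q)
      (fun w hw => locForm_dJ hF.smooth_energy hw a) hz, fderiv_fderiv_const (hL.smooth z hz),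
      hS.isSpray.loc_eq hz]
    simp
  have h2 : deriveAlong (constField q (a, (0 : Model n)))
      (fun w => dJ (fun v => F v ^ 2) w (S w)) (param q z) =
        2 * fderiv ℝ (fun w => F (param q w) ^ 2) z (a, 0) := by
    have h3 : (fun w => dJ (fun v => F v ^ 2) (param q w) (S (param q w))) =ᶠ[𝓝 z]
        fun w => 2 * F (param q w) ^ 2 := by
      filter_upwards [eventually_slit hz] with w hw
      rw [hsb.apply_param hw, locForm_dJ hF.smooth_energy hw, hS.isSpray.loc_eq hw]
      exact hL.euler w hw
    have hd2 := smooth_diff (hL.smooth z hz)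
    rw [deriveAlong_param hz.1 ((hd2.const_mul 2).congr_of_eventuallyEq h3), h3.fderiv_eq,
      fderiv_const_mul hd2, loc_constField hz.1]
    rfl
  have h3 : dJ (fun v => F v ^ 2) (param q z) (bracket S (constField q (a, (0 : Model n)))
      (param q z)) = 0 := by
    rw [hsb.apply_param hz, hS.isSpray.loc_bracket hz hX, hX0, loc_constField hz.1]
    simp
  have h4 := hS.euler_lagrange _ (param_mem_slit hz) _ hX
  rw [extD, h1, h2, h3, deriveAlong_param hz.1 (smooth_diff (hL.smooth z hz)),
    loc_constField hz.1] at h4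
  linarith

/-- The Jacobi endomorphism at `v` is that of constant flag curvature `κ`. -/
def FlagCurvatureAt (F : TangentBundle (𝓡 n) M → ℝ) (S : VField (n := n) M) (κ : ℝ)
    (v : TangentBundle (𝓡 n) M) : Prop :=
  ∀ X : VField (n := n) M, SmoothNear X v →
    jacobiEnd S X v = κ • (F v ^ 2 • opJ X v - (F v * dJ F v (X v)) • liouville v)

lemma flagCurvatureAt_iff (hF : IsFinsler F) (hS : IsSpray S) {κ : ℝ} (hz : z ∈ slitDomain q) :
    FlagCurvatureAt F S κ (param q z) ↔ ∀ a, jac (coeff q S) z a = (κ * F (param q z) ^ 2) • a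
      - (κ / 2 * fderiv ℝ (fun w => F (param q w) ^ 2) z (0, a)) • z.2 := by
  have hd := smooth_diff (contDiffAt_param_of_smooth hF.smooth hz)
  have h1 : ∀ X : VField (n := n) M,
      κ • (F (param q z) ^ 2 • opJ X (param q z)
        - (F (param q z) * dJ F (param q z) (X (param q z))) • liouville (param q z)) =
      (κ * F (param q z) ^ 2) • opJ X (param q z)
        - (κ / 2 * fderiv ℝ (fun w => F (param q w) ^ 2) z (0, (loc q X z).1)) •
          liouville (param q z) := by
    intro X
    rw [dJ_param hz.1 hd, fderiv_fun_pow _ hd, smul_sub, smul_smul, smul_smul]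
    congr 2
    simp
    ring
  simp only [FlagCurvatureAt, h1]
  constructor
  · intro h a
    have h2 := h (constField q (a, 0)) (smoothNear_constField hz.1 _)
    rwa [hS.jacobiEnd_constField_iff hz, loc_constField hz.1] at h2
  · intro h X hX
    exact (hS.jacobiEnd_eq_iff hz hX _ _).2 (h _)

lemma isHamel_iff (hS : IsSpray S) (hP : IsSmoothFun P) (hP' : PosHomogeneous P) :
    IsHamel S P ↔ ∀ q : TangentBundle (𝓡 n) M, ∀ z ∈ slitDomain q, ∀ a c,
      dhForm (coeff q S) (fun w a => fderiv ℝ (fun w => P (param q w)) w (0, a)) z a c = 0 := by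
  have key : ∀ q : TangentBundle (𝓡 n) M, ∀ z ∈ slitDomain q, ∀ X Y : VField (n := n) M,
      SmoothNear X (param q z) → SmoothNear Y (param q z) →
      dAlong (opH S) (dJ P) X Y (param q z) = dhForm (coeff q S)
        (fun w a => fderiv ℝ (fun w => P (param q w)) w (0, a)) z (loc q X z).1 (loc q Y z).1 := by
    intro q z hz X Y hX hY
    have hE : EulerOn (slitDomain q) 1 (fun w => P (param q w)) := hP'.eulerOn hP
    rw [hS.dAlong_opH (isSemibasic_dJ P) hz (differentiableAt_locForm (fun a w hw =>
      ((hE.vert (isOpen_slitDomain q) a).smooth w hw).congr_of_eventuallyEq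
        ((eventually_slit hw).mono fun u hu => locForm_dJ hP hu a)) hz) hX hY,
      dhForm_congr (isOpen_slitDomain q) (fun w hw a => locForm_dJ hP hw a) hz]
  constructor
  · intro h q z hz a c
    have hX := smoothNear_constField hz.1 (a, (0 : Model n))
    have hY := smoothNear_constField hz.1 (c, (0 : Model n))
    have h1 := h.hamel _ (param_mem_slit hz) _ _ hX hY
    rwa [key q z hz _ _ hX hY, loc_constField hz.1, loc_constField hz.1] at h1
  · refine fun h => ⟨hP, hP', fun v hv X Y hX hY => ?_⟩
    obtain ⟨q, z, hz, rfl⟩ := exists_chart hv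
    rw [key q z hz X Y hX hY]
    exact h q z hz _ _

end Finsler

end

section

variable {n : ℕ} {M : Type*} [TopologicalSpace M] [ChartedSpace (EuclideanSpace ℝ (Fin n)) M]
  [IsManifold (𝓡 n) ∞ M]

/-! ### Constant flag curvature and Hamel functions -/

section Flag

variable {q : TangentBundle (𝓡 n) M} {z : Model n × Model n} {S S' : VField (n := n) M}
  {F F' P : TangentBundle (𝓡 n) M → ℝ}

lemma FlagCurvatureAt.unique (hn : 1 < n) (hF : IsFinsler F) (hS : IsSpray S) {κ κ' : ℝ}
    {v : TangentBundle (𝓡 n) M} (hv : v ∈ slit M) (h : FlagCurvatureAt F S κ v)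
    (h' : FlagCurvatureAt F S κ' v) : κ = κ' := by
  obtain ⟨q, z, hz, rfl⟩ := exists_chart hv
  rw [flagCurvatureAt_iff hF hS hz] at h h'
  have hp := hF.energy_pos z hz
  have h1 := (notLine_of_rank (one_lt_rank_model hn)).eq_zero
    (r := κ * F (param q z) ^ 2 - κ' * F (param q z) ^ 2)
    (s := fun a => κ / 2 * fderiv ℝ (fun w => F (param q w) ^ 2) z (0, a)
      - κ' / 2 * fderiv ℝ (fun w => F (param q w) ^ 2) z (0, a)) hz.2 (fun a => by
        have h2 := (h a).symm.trans (h' a)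
        rw [sub_smul, sub_smul]
        exact sub_eq_sub_iff_sub_eq_sub.1 h2)
  have h2 := h1.1
  rw [← sub_mul] at h2
  exact sub_eq_zero.1 ((mul_eq_zero.1 h2).resolve_right hp.ne')

lemma constFlag_of_flagCurvatureAt {κ : ℝ} (hF : IsFinsler F) (hS : IsSpray S)
    (h : ∀ v ∈ slit M, FlagCurvatureAt F S κ v) (q : TangentBundle (𝓡 n) M) :
    ConstFlag (slitDomain q) (coeff q S) (fun w => F (param q w) ^ 2) κ :=
  fun _ hz => (flagCurvatureAt_iff hF hS hz).1 (h _ (param_mem_slit hz))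

/-- On a connected manifold, locally constant flag curvature is constant. -/
lemma hasConstantFlagCurvature_of_local [ConnectedSpace M] (hn : 1 < n) (hF : IsFinsler F)
    (hS : IsSpray S) (h : ∀ p : M, ∃ κ, ∀ᶠ p' in 𝓝 p, ∀ v ∈ slit M, v.1 = p' →
      FlagCurvatureAt F S κ v) : HasConstantFlagCurvature F S := by
  choose K hK using h
  obtain ⟨u, hu⟩ := exists_ne_zero_model hn
  have hloc : IsLocallyConstant K := by
    rw [IsLocallyConstant.iff_eventually_eq]
    intro p
    filter_upwards [hK p] with p' hp'
    have hv : (⟨p', u⟩ : TangentBundle (𝓡 n) M) ∈ slit M := hu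
    exact ((hK p').self_of_nhds _ hv rfl).unique hn hF hS hv (hp' _ hv rfl)
  obtain ⟨p₀⟩ := (inferInstance : Nonempty M)
  refine ⟨K p₀, fun v hv => ?_⟩
  rw [hloc.apply_eq_of_preconnectedSpace p₀ v.1]
  exact (hK v.1).self_of_nhds v hv rfl

/-- If both metrics have constant flag curvature, then the projective factor is a Hamel function. -/
lemma HasConstantFlagCurvature.isHamel (hn : 1 < n) (hF : IsFinsler F) (hF' : IsFinsler F')
    (hS : IsSpray S) (hS' : IsSpray S') (hP : IsProjectiveFactor S S' P)
    (h : HasConstantFlagCurvature F S) (h' : HasConstantFlagCurvature F' S') : IsHamel S P := by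
  obtain ⟨κ, hκ⟩ := h
  obtain ⟨κ', hκ'⟩ := h'
  rw [isHamel_iff hS hP.smooth hP.homogeneous]
  intro q z hz a c
  exact (constFlag_of_flagCurvatureAt hF hS hκ q).hamel
    (notLine_of_rank (one_lt_rank_model hn)) slitDomain_ne_zero (isOpen_slitDomain q) hS.coeff_euler
    hP.eulerOn hP.coeff hF.eulerOn hF'.eulerOn
    (constFlag_of_flagCurvatureAt hF' hS' hκ' q) hz a c

/-- A projective change by a Hamel function preserves constant flag curvature. -/
lemma IsHamel.hasConstantFlagCurvature [ConnectedSpace M] (hn : 1 < n) (hF : IsFinsler F)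
    (hF' : IsFinsler F') (hS : IsGeodesicSpray F S) (hS' : IsGeodesicSpray F' S')
    (hP : IsProjectiveFactor S S' P) (h : HasConstantFlagCurvature F S) (hH : IsHamel S P) :
    HasConstantFlagCurvature F' S' := by
  obtain ⟨κ, hκ⟩ := h
  rw [isHamel_iff hS.isSpray hP.smooth hP.homogeneous] at hH
  have hr := one_lt_rank_model hn
  refine hasConstantFlagCurvature_of_local hn hF' hS'.isSpray fun p => ?_
  obtain ⟨u, hu⟩ := exists_ne_zero_model hn
  obtain ⟨q, rfl⟩ : ∃ q : TangentBundle (𝓡 n) M, q.1 = p := ⟨⟨p, u⟩, rfl⟩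
  have hmem : (extChartAt (𝓡 n) q.1 q.1, u) ∈ slitDomain q :=
    ⟨mem_extChartAt_target q.1, hu⟩
  obtain ⟨k, hks, hkv, hkw, hkj⟩ := (constFlag_of_flagCurvatureAt hF hS.isSpray hκ q).of_hamel
    (notLine_of_rank hr) slitDomain_ne_zero (isOpen_slitDomain q) hS.isSpray.coeff_euler
    hS'.isSpray.coeff_euler hP.eulerOn hP.coeff hF.eulerOn hF'.eulerOn hF'.energy_pos
    (hS.eulerLagrange hF) (hS'.eulerLagrange hF') (hH q)
  have hev := locally_const_of_wedge hr (isOpen_extChartAt_target q.1) rfl hF'.eulerOn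
    hF'.energy_pos hks hkv hkw hmem
  refine ⟨k (extChartAt (𝓡 n) q.1 q.1, u), ?_⟩
  filter_upwards [(continuousAt_extChartAt (I := 𝓡 n) q.1).eventually hev,
    extChartAt_source_mem_nhds (I := 𝓡 n) q.1] with p' hp' hsrc v hv hvp
  subst hvp
  obtain ⟨w, hw, rfl⟩ := exists_param_slit hsrc hv
  have h1 : extChartAt (𝓡 n) q.1 (param q w).1 = w.1 :=
    (extChartAt (𝓡 n) q.1).right_inv hw.1
  rw [h1] at hp'
  rw [flagCurvatureAt_iff hF' hS'.isSpray hw, ← hp' w.2 hw.2]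
  exact hkj w hw

lemma IsProjectiveFactor.symm (hP : IsProjectiveFactor S S' P) :
    IsProjectiveFactor S' S (fun v => -P v) where
  smooth := hP.smooth.neg
  homogeneous v hv t ht := by simp only [hP.homogeneous v hv t ht, mul_neg]
  eq v hv := by
    rw [hP.eq v hv]
    module

/-- The condition `d_h d_J P = 0` does not depend on which of the two sprays defines `h`. -/
lemma IsProjectiveFactor.isHamel_symm (hP : IsProjectiveFactor S S' P) (hS : IsSpray S)
    (hS' : IsSpray S') : IsHamel S' (fun v => -P v) ↔ IsHamel S P := by
  rw [isHamel_iff hS' hP.symm.smooth hP.symm.homogeneous, isHamel_iff hS hP.smooth hP.homogeneous]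
  refine forall_congr' fun q => forall₂_congr fun z hz => forall₂_congr fun a c => ?_
  have hE := hP.eulerOn (q := q)
  rw [← dhForm_dJ_proj (isOpen_slitDomain q) hS.coeff_euler hE hP.coeff hz,
    dhForm_dJ (hE.smooth z hz), dhForm_dJ (hP.symm.eulerOn.smooth z hz)]
  have h1 : fderiv ℝ (fun w => -P (param q w)) = -fderiv ℝ (fun w => P (param q w)) := by
    funext w
    exact fderiv_fun_neg
  rw [h1, fderiv_neg, neg_apply, neg_apply, neg_apply, neg_apply, neg_sub_neg, ← neg_sub,
    neg_eq_zero]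

/-- If `F` has constant flag curvature, then `F'` has if and only if the projective factor is a
Hamel function. -/
lemma HasConstantFlagCurvature.iff_isHamel [ConnectedSpace M] (hn : 1 < n) (hF : IsFinsler F)
    (hF' : IsFinsler F') (hS : IsGeodesicSpray F S) (hS' : IsGeodesicSpray F' S')
    (hP : IsProjectiveFactor S S' P) (h : HasConstantFlagCurvature F S) :
    HasConstantFlagCurvature F' S' ↔ IsHamel S P :=
  ⟨h.isHamel hn hF hF' hS.isSpray hS'.isSpray hP,
    fun hH => hH.hasConstantFlagCurvature hn hF hF' hS hS' hP h⟩

end Flag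

end

section

variable {n : ℕ} {M : Type*} [TopologicalSpace M] [ChartedSpace (EuclideanSpace ℝ (Fin n)) M]
  [IsManifold (𝓡 n) ∞ M]

/-! ### Projectively related sprays have a projective factor -/

/-- Euler's equation of degree `2` integrates to homogeneity along rays: `t⁻² f(x, t y)` has zero
derivative. -/
lemma EulerOn.homogeneous_two {E W : Type*} [NormedAddCommGroup E] [NormedSpace ℝ E]
    [NormedAddCommGroup W] [NormedSpace ℝ W] {Ω : Set (E × E)} {f : E × E → W}
    (hf : EulerOn Ω 2 f) {z : E × E} (hz : ∀ t : ℝ, 0 < t → (z.1, t • z.2) ∈ Ω) {t : ℝ}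
    (ht : 0 < t) : f (z.1, t • z.2) = t ^ 2 • f z := by
  have hd : ∀ t ∈ Set.Ioi (0 : ℝ), HasDerivAt (fun t : ℝ => (t ^ 2)⁻¹ • f (z.1, t • z.2)) 0 t := by
    intro t ht
    have ht0 : t ≠ 0 := (Set.mem_Ioi.1 ht).ne'
    have hm := hz t ht
    have h1 : HasDerivAt (fun t : ℝ => (z.1, t • z.2)) (0, z.2) t := by
      simpa using (hasDerivAt_const t z.1).prodMk ((hasDerivAt_id t).smul_const z.2)
    have h2 := (smooth_diff (hf.smooth _ hm)).hasFDerivAt.comp_hasDerivAt t h1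
    have h3 := ((hasDerivAt_pow 2 t).inv (pow_ne_zero 2 ht0)).smul h2
    have h4 : t • fderiv ℝ f (z.1, t • z.2) (0, z.2) = (2 : ℝ) • f (z.1, t • z.2) := by
      rw [← hf.euler _ hm, ← map_smul, Prod.smul_mk, smul_zero]
    have h5 : fderiv ℝ f (z.1, t • z.2) (0, z.2) = (2 * t⁻¹) • f (z.1, t • z.2) := by
      rw [mul_comm, mul_smul, ← h4, smul_smul, inv_mul_cancel₀ ht0, one_smul]
    refine h3.congr_deriv ?_
    change (t ^ 2)⁻¹ • fderiv ℝ f (z.1, t • z.2) (0, z.2) +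
      (-(((2 : ℕ) : ℝ) * t ^ (2 - 1)) / (t ^ 2) ^ 2) • f (z.1, t • z.2) = 0
    rw [h5, smul_smul, ← add_smul]
    convert zero_smul ℝ _
    push_cast
    field_simp
    ring
  have h1 := IsOpen.is_const_of_deriv_eq_zero isOpen_Ioi isPreconnected_Ioi
    (fun t ht => (hd t ht).differentiableAt.differentiableWithinAt) (fun t ht => (hd t ht).deriv)
    (Set.mem_Ioi.2 ht) (Set.mem_Ioi.2 (zero_lt_one (α := ℝ)))
  simp only [one_pow, inv_one, one_smul] at h1
  change _ = t ^ 2 • f (z.1, z.2)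
  rw [← h1, smul_smul, mul_inv_cancel₀ (pow_ne_zero 2 ht.ne'), one_smul]

section Geodesics

variable {q : TangentBundle (𝓡 n) M} {z : Model n × Model n} {S S' : VField (n := n) M}

lemma isOpen_slit : IsOpen (slit M : Set (TangentBundle (𝓡 n) M)) := by
  rw [isOpen_iff_mem_nhds]
  intro v hv
  obtain ⟨q, z, hz, rfl⟩ := exists_chart hv
  exact eventually_of_param hz.1 ((eventually_slit hz).mono fun w hw => param_mem_slit hw)

lemma IsSpray.dproj_apply (hS : IsSpray S) {v : TangentBundle (𝓡 n) M} (hv : v ∈ slit M) :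
    dproj v (S v) = v.2 := by
  obtain ⟨q, z, hz, rfl⟩ := exists_chart hv
  rw [← paramD_loc hz.1 S, dproj_paramD hz.1, hS.loc_eq hz]
  rfl

/-- The velocity of the projection to `M` of an integral curve of a spray is the curve itself. -/
lemma IsSpray.hasMFDerivAt_proj (hS : IsSpray S) {γ : ℝ → TangentBundle (𝓡 n) M} {t : ℝ}
    (hγ : HasMFDerivAt 𝓘(ℝ, ℝ) (𝓡 n).tangent γ t ((1 : ℝ →L[ℝ] ℝ).smulRight (S (γ t))))
    (ht : γ t ∈ slit M) : HasMFDerivAt 𝓘(ℝ, ℝ) (𝓡 n) (fun t => (γ t).1) t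
      ((1 : ℝ →L[ℝ] ℝ).smulRight (γ t).2) := by
  have h1 : HasMFDerivAt (𝓡 n).tangent (𝓡 n) (fun w : TangentBundle (𝓡 n) M => w.1) (γ t)
      (dproj (γ t)) :=
    ((Bundle.contMDiff_proj (n := ∞) (TangentSpace (𝓡 n) : M → Type _)).mdifferentiable
      (by simp) _).hasMFDerivAt
  have h2 := h1.comp t hγ
  have h3 : (dproj (γ t)).comp ((1 : ℝ →L[ℝ] ℝ).smulRight (S (γ t))) =
      (1 : ℝ →L[ℝ] ℝ).smulRight ((γ t).2 : Model n) := by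
    ext1
    simp only [ContinuousLinearMap.comp_apply, ContinuousLinearMap.smulRight_apply, map_smul,
      hS.dproj_apply ht]
    rfl
  exact h3 ▸ h2

/-- The chart expression of an integral curve of `S` is an integral curve of `loc q S`. -/
lemma hasDerivAt_chart {γ : ℝ → TangentBundle (𝓡 n) M} {t : ℝ} (hz : z ∈ coordDomain q)
    (hγ : HasMFDerivAt 𝓘(ℝ, ℝ) (𝓡 n).tangent γ t ((1 : ℝ →L[ℝ] ℝ).smulRight (S (γ t))))
    (ht : γ t = param q z) :
    HasDerivAt (fun t => extChartAt (𝓡 n).tangent q (γ t)) (loc q S z) t := by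
  have h1 := hasMFDerivAt_chart_param hz
  have h2 : HasMFDerivAt (𝓡 n).tangent 𝓘(ℝ, Model n × Model n)
      (extChartAt (𝓡 n).tangent q) (γ t) (paramD q z).inverse := by
    rw [ht]
    exact h1
  have h3 : (S (γ t) : Model n × Model n) = S (param q z) :=
    congrArg (fun v => (S v : Model n × Model n)) ht
  have h4 : (paramD q z).inverse.comp ((1 : ℝ →L[ℝ] ℝ).smulRight (S (γ t) : Model n × Model n)) =
      ContinuousLinearMap.toSpanSingleton ℝ (loc q S z) := by
    ext1
    change (paramD q z).inverse ((1 : ℝ) • (S (γ t) : Model n × Model n)) = (1 : ℝ) • loc q S z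
    rw [one_smul, one_smul, loc, h3]
  have h5 : HasFDerivAt (fun t => extChartAt (𝓡 n).tangent q (γ t))
      ((paramD q z).inverse.comp ((1 : ℝ →L[ℝ] ℝ).smulRight (S (γ t) : Model n × Model n))) t :=
    (h2.comp t hγ).hasFDerivAt
  rw [h4] at h5
  exact h5

lemma velocity_eq {c : ℝ → M} {t : ℝ} {u : Model n}
    (h : HasMFDerivAt 𝓘(ℝ, ℝ) (𝓡 n) c t ((1 : ℝ →L[ℝ] ℝ).smulRight u)) :
    velocity (n := n) c t = ⟨c t, u⟩ := by
  have h1 : mfderiv 𝓘(ℝ, ℝ) (𝓡 n) c t (1 : ℝ) = u := by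
    rw [h.mfderiv]
    exact one_smul ℝ u
  rw [velocity, h1]

lemma smul_mem_slitDomain (hz : z ∈ slitDomain q) (t : ℝ) (ht : 0 < t) :
    (z.1, t • z.2) ∈ slitDomain q :=
  ⟨hz.1, smul_ne_zero ht.ne' hz.2⟩

/-- Every vector of `T₀M` is the initial velocity of a geodesic. -/
lemma IsSpray.exists_geodesic (hS : IsSpray S) {v : TangentBundle (𝓡 n) M} (hv : v ∈ slit M) :
    ∃ (γ : ℝ → TangentBundle (𝓡 n) M) (A : Set ℝ), γ 0 = v ∧ 0 ∈ A ∧ IsOpen A ∧ A.OrdConnected ∧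
      IsGeodesicOn S (fun t => (γ t).1) A ∧
      ∀ t ∈ A, γ t ∈ slit M ∧
        HasMFDerivAt 𝓘(ℝ, ℝ) (𝓡 n).tangent γ t ((1 : ℝ →L[ℝ] ℝ).smulRight (S (γ t))) := by
  obtain ⟨γ, h0, hγ⟩ := exists_isMIntegralCurveAt_of_contMDiffAt_boundaryless (t₀ := 0)
    ((hS.smooth v hv).contMDiffAt.of_le (m := 1) (by exact_mod_cast le_top))
  have hev : ∀ᶠ t in 𝓝 (0 : ℝ), γ t ∈ slit M ∧
      HasMFDerivAt 𝓘(ℝ, ℝ) (𝓡 n).tangent γ t ((1 : ℝ →L[ℝ] ℝ).smulRight (S (γ t))) := by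
    refine Filter.Eventually.and ?_ hγ
    refine hγ.continuousAt.eventually (isOpen_slit.mem_nhds ?_)
    rwa [h0]
  obtain ⟨ε, hε, hball⟩ := Metric.eventually_nhds_iff_ball.1 hev
  have hvel : ∀ t ∈ Metric.ball (0 : ℝ) ε, velocity (n := n) (fun t => (γ t).1) t = γ t :=
    fun t ht => velocity_eq (hS.hasMFDerivAt_proj (hball t ht).2 (hball t ht).1)
  refine ⟨γ, Metric.ball 0 ε, h0, Metric.mem_ball_self hε, Metric.isOpen_ball,
    (convex_ball 0 ε).ordConnected, ⟨fun t ht => ?_, fun t ht => ?_⟩, hball⟩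
  · rw [hvel t ht]
    exact (hball t ht).1
  · have h1 : (S (velocity (n := n) (fun t => (γ t).1) t) : Model n × Model n) = S (γ t) :=
      congrArg (fun v => (S v : Model n × Model n)) (hvel t ht)
    have h2 := (hball t ht).2.congr_of_eventuallyEq (f₁ := velocity fun t => (γ t).1)
      (Filter.eventuallyEq_of_mem (Metric.isOpen_ball.mem_nhds ht) hvel)
    have h3 := h2.hasMFDerivWithinAt (s := Metric.ball 0 ε)
    exact h1 ▸ h3

/-- If the geodesics of `S` are reparametrised geodesics of `S'`, then the coefficients of the two
sprays differ by a multiple of the Liouville field: in a chart, a geodesic `x` of `S` satisfies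
`x'' = -2 G(x, x')`, and the same equation for `G'` and `x ∘ φ` determines `G' - G`. -/
lemma GeodesicsReparametrise.exists_coeff (h : GeodesicsReparametrise S S') (hS : IsSpray S)
    (hS' : IsSpray S') (hz : z ∈ slitDomain q) :
    ∃ s : ℝ, coeff q S' z = coeff q S z + s • z.2 := by
  obtain ⟨γ, A, h0, hA0, hA, hAc, hgeo, hγ⟩ := hS.exists_geodesic (param_mem_slit hz)
  obtain ⟨B, φ, hB, -, hφ, hφ', hAB, hslit, hint⟩ := h _ A hA hAc hgeo
  obtain ⟨s₀, hs₀, hφs⟩ : ∃ s ∈ B, φ s = 0 := by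
    rw [← hAB] at hA0
    exact hA0
  have hφd : ∀ s ∈ B, HasDerivAt φ (deriv φ s) s := fun s hs =>
    ((hφ.contDiffAt (hB.mem_nhds hs)).differentiableAt (by simp)).hasDerivAt
  have hφ2 : HasDerivAt (deriv φ) (deriv (deriv φ) s₀) s₀ :=
    (((hφ.deriv_of_isOpen (m := ∞) hB (by simp)).contDiffAt
      (hB.mem_nhds hs₀)).differentiableAt (by simp)).hasDerivAt
  have hvel : ∀ s ∈ B, velocity (n := n) ((fun t => (γ t).1) ∘ φ) s =
      ⟨(γ (φ s)).1, deriv φ s • (γ (φ s)).2⟩ := by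
    intro s hs
    have hs' : φ s ∈ A := hAB ▸ Set.mem_image_of_mem φ hs
    have h1 := hS.hasMFDerivAt_proj (hγ _ hs').2 (hγ _ hs').1
    have h2 := h1.comp s (hφd s hs).hasFDerivAt.hasMFDerivAt
    have h3 : ((1 : ℝ →L[ℝ] ℝ).smulRight ((γ (φ s)).2 : Model n)).comp
        (ContinuousLinearMap.toSpanSingleton ℝ (deriv φ s)) =
        (1 : ℝ →L[ℝ] ℝ).smulRight (deriv φ s • ((γ (φ s)).2 : Model n)) := by
      ext1
      simp
    exact velocity_eq (h3 ▸ h2)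
  set r := deriv φ s₀ with hr
  have hrpos : 0 < r := hφ' s₀ hs₀
  have hz₁ := smul_mem_slitDomain hz r hrpos
  -- the chart expression of the geodesic of `S`
  have hd1 : HasDerivAt (fun t => extChartAt (𝓡 n).tangent q (γ t)) (sprayVec (coeff q S) z)
      (φ s₀) := by
    rw [← hS.loc_eq hz, hφs]
    exact hasDerivAt_chart hz.1 (hγ 0 hA0).2 h0
  have hz0 : extChartAt (𝓡 n).tangent q (γ (φ s₀)) = z := by
    rw [hφs, h0, extChartAt_param hz.1]
  -- the chart expression of the geodesic of `S'`, from the equation of `S'`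
  have hd2 : HasDerivAt
      (fun s => extChartAt (𝓡 n).tangent q (velocity ((fun t => (γ t).1) ∘ φ) s))
      (sprayVec (coeff q S') (z.1, r • z.2)) s₀ := by
    rw [← hS'.loc_eq hz₁]
    refine hasDerivAt_chart hz₁.1 ((hint s₀ hs₀).hasMFDerivAt (hB.mem_nhds hs₀)) ?_
    rw [hvel s₀ hs₀, param_smul, hφs, h0]
  -- and from the chain rule
  have hd5 : HasDerivAt (fun s => (extChartAt (𝓡 n).tangent q (γ (φ s))).2)
      (r • (sprayVec (coeff q S) z).2) s₀ :=
    (hd1.scomp s₀ (hφd s₀ hs₀)).hasFDerivAt.snd.hasDerivAt.congr_deriv (by simp [hr])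
  have hd3 := hφ2.smul hd5
  have heq : (fun s => (extChartAt (𝓡 n).tangent q (velocity ((fun t => (γ t).1) ∘ φ) s)).2)
      =ᶠ[𝓝 s₀] fun s => deriv φ s • (extChartAt (𝓡 n).tangent q (γ (φ s))).2 := by
    have hcont : ContinuousAt (fun s => γ (φ s)) s₀ := by
      refine ContinuousAt.comp ?_ (hφd s₀ hs₀).continuousAt
      rw [hφs]
      exact (hγ 0 hA0).2.1
    have hsrc : γ (φ s₀) ∈ (extChartAt (𝓡 n).tangent q).source := by
      rw [hφs, h0]
      exact param_mem_source hz.1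
    filter_upwards [hB.mem_nhds hs₀, hcont.eventually
      ((isOpen_extChartAt_source q).mem_nhds hsrc)] with s hs hs'
    have hm := (extChartAt (𝓡 n).tangent q).map_source hs'
    rw [extChartAt_target_eq] at hm
    have h1 : γ (φ s) = param q (extChartAt (𝓡 n).tangent q (γ (φ s))) :=
      ((extChartAt (𝓡 n).tangent q).left_inv hs').symm
    have h2 : (⟨(γ (φ s)).1, deriv φ s • (γ (φ s)).2⟩ : TangentBundle (𝓡 n) M) =
        param q ((extChartAt (𝓡 n).tangent q (γ (φ s))).1,
          deriv φ s • (extChartAt (𝓡 n).tangent q (γ (φ s))).2) := by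
      rw [param_smul, ← h1]
    rw [hvel s hs, h2, extChartAt_param]
    exact hm
  have hd4 : HasDerivAt
      (fun s => (extChartAt (𝓡 n).tangent q (velocity ((fun t => (γ t).1) ∘ φ) s)).2)
      (sprayVec (coeff q S') (z.1, r • z.2)).2 s₀ :=
    hd2.hasFDerivAt.snd.hasDerivAt.congr_deriv (by simp)
  have h1 := hd4.unique (hd3.congr_of_eventuallyEq heq)
  simp only [sprayVec, hz0] at h1
  rw [hS'.coeff_euler.homogeneous_two (smul_mem_slitDomain hz) hrpos] at h1
  refine ⟨-(deriv (deriv φ) s₀ / (2 * r ^ 2)), ?_⟩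
  have h2 : 2 * r ^ 2 ≠ 0 := by positivity
  have h3 : (2 : ℝ) • r ^ 2 • coeff q S' z =
      (2 * r ^ 2) • coeff q S z - deriv (deriv φ) s₀ • z.2 := by
    rw [← neg_inj, h1]
    module
  refine smul_right_injective (Model n) h2 ?_
  change (2 * r ^ 2) • coeff q S' z = _ • (_ + _)
  rw [mul_smul, h3, smul_add, smul_smul, mul_neg, mul_div_cancel₀ _ h2, neg_smul, sub_eq_add_neg]

/-- Projectively related sprays have a projective factor. -/
lemma GeodesicsReparametrise.exists_isProjectiveFactor (h : GeodesicsReparametrise S S')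
    (hS : IsSpray S) (hS' : IsSpray S') : ∃ P, IsProjectiveFactor S S' P := by
  have key : ∀ v : TangentBundle (𝓡 n) M, ∃ s : ℝ, v ∈ slit M →
      S' v = S v - (2 * s) • liouville v := by
    intro v
    by_cases hv : v ∈ slit M
    · obtain ⟨q, z, hz, rfl⟩ := exists_chart hv
      obtain ⟨s, hs⟩ := h.exists_coeff hS hS' hz
      refine ⟨s, fun _ => ?_⟩
      refine eq_of_loc_eq hz.1 (Y := S - (2 * s) • liouville) ?_
      rw [loc_sub hz.1, loc_smul hz.1, loc_liouville hz.1, hS.loc_eq hz, hS'.loc_eq hz]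
      ext1
      · simp [sprayVec]
      · simp only [sprayVec, hs, Prod.snd_sub, Prod.smul_snd]
        module
    · exact ⟨0, fun h => absurd h hv⟩
  choose P hP using key
  have hloc : ∀ q : TangentBundle (𝓡 n) M, ∀ w ∈ slitDomain q,
      coeff q S' w = coeff q S w + P (param q w) • w.2 := fun q => coeff_eq_add hP
  refine ⟨P, isSmoothFun_of_param fun q z hz => ?_, fun v hv t ht => ?_, hP⟩
  -- `P` is the quotient of `⟨y, G' - G⟩` by `⟨y, y⟩`
  · have h1 : ContDiffAt ℝ ∞ (fun w : Model n × Model n =>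
        inner ℝ w.2 (coeff q S' w - coeff q S w) / inner ℝ w.2 w.2) z :=
      (contDiffAt_snd.inner ℝ ((hS'.contDiffAt_coeff hz).sub (hS.contDiffAt_coeff hz))).div
        (contDiffAt_snd.inner ℝ contDiffAt_snd) (inner_self_ne_zero.2 hz.2)
    refine h1.congr_of_eventuallyEq ?_
    filter_upwards [eventually_slit hz] with w hw
    rw [hloc q w hw, add_sub_cancel_left, inner_smul_right,
      mul_div_cancel_right₀ _ (inner_self_ne_zero.2 hw.2)]
  · obtain ⟨q, z, hz, rfl⟩ := exists_chart hv
    have hz' := smul_mem_slitDomain hz t ht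
    have h1 := hloc q _ hz'
    rw [hS.coeff_euler.homogeneous_two (smul_mem_slitDomain hz) ht,
      hS'.coeff_euler.homogeneous_two (smul_mem_slitDomain hz) ht, hloc q z hz, smul_add,
      add_right_inj, smul_smul, smul_smul] at h1
    have h2 := smul_left_injective ℝ hz.2 h1
    rw [← param_smul]
    have h3 : t * (t * P (param q z)) = t * P (param q (z.1, t • z.2)) := by
      linarith
    exact (mul_left_cancel₀ ht.ne' h3).symm

end Geodesics

end

end SprayGeometry

end

theorem mainTheorem2 {n : ℕ} (hn : 1 < n) {M : Type*} [TopologicalSpace M]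
    [ChartedSpace (EuclideanSpace ℝ (Fin n)) M] [IsManifold (𝓡 n) ∞ M] [ConnectedSpace M] :
    (∀ (F F' : TangentBundle (𝓡 n) M → ℝ) (S S' : SprayGeometry.VField (n := n) M),
      SprayGeometry.IsFinsler F → SprayGeometry.IsFinsler F' →
      SprayGeometry.IsGeodesicSpray F S → SprayGeometry.IsGeodesicSpray F' S' →
        (SprayGeometry.ProjectivelyRelated S S' →
          ∃ P, SprayGeometry.IsProjectiveFactor S S' P) ∧
        ∀ P, SprayGeometry.IsProjectiveFactor S S' P →
          (SprayGeometry.HasConstantFlagCurvature F S →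
            (SprayGeometry.HasConstantFlagCurvature F' S' ↔ SprayGeometry.IsHamel S P)) ∧
          (SprayGeometry.HasConstantFlagCurvature F' S' →
            (SprayGeometry.HasConstantFlagCurvature F S ↔ SprayGeometry.IsHamel S P))) ∧
    (∀ (S S' : SprayGeometry.VField (n := n) M) (P : TangentBundle (𝓡 n) M → ℝ),
      SprayGeometry.IsSpray S → SprayGeometry.IsSpray S' →
      SprayGeometry.IsProjectiveFactor S S' P →
      ∀ ξ, SprayGeometry.IsCurvatureForm S ξ →
        (∃ ξ', SprayGeometry.IsCurvatureForm S' ξ') ∧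
        ∀ ξ', SprayGeometry.IsCurvatureForm S' ξ' →
          ∀ v ∈ SprayGeometry.slit M, ∀ X Y : SprayGeometry.VField (n := n) M,
            SprayGeometry.SmoothNear X v → SprayGeometry.SmoothNear Y v →
              SprayGeometry.dAlong (SprayGeometry.opH S') ξ' X Y v =
                SprayGeometry.dAlong (SprayGeometry.opH S) ξ X Y v) := by
  refine ⟨fun F F' S S' hF hF' hS hS' => ⟨fun h => ?_, fun P hP => ⟨fun hc => ?_, fun hc => ?_⟩⟩,
    fun S S' P hS hS' hP ξ hξ => ⟨?_, fun ξ' hξ' v hv X Y hX hY => ?_⟩⟩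
  · exact h.1.exists_isProjectiveFactor hS.isSpray hS'.isSpray
  · exact hc.iff_isHamel hn hF hF' hS hS' hP
  · rw [hc.iff_isHamel hn hF' hF hS' hS hP.symm, hP.isHamel_symm hS.isSpray hS'.isSpray]
  · obtain ⟨ρ, α, h, -⟩ := hξ
    obtain ⟨ρ', α', h'⟩ := h.proj hS hS' hP
    exact ⟨fun v => (1 / 3 : ℝ) • (α' v + SprayGeometry.dJ ρ' v), ρ', α', h', fun _ _ => rfl⟩
  · exact SprayGeometry.dAlong_curvature hn hS hS' hP hξ hξ' hv hX hY
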